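/- **Setting.** Let $(\mu_k)_{k\ge0}$ be a sequence of complex numbers, $\mathcal L$ the linear form on $\mathbb C[x]$ with $\mathcal L(x^k)=\mu_k$, and $f(z)=\sum_{k\ge0}\mu_kz^{-k-1}$ its formal series. Let $p_n=\gamma_nz^n+\cdots$ ($\gamma_n\ne0$, $n\ge0$) be formal orthonormal polynomials, $\mathcal L(p_np_l)=\delta_{n,l}$. Put $a_n=\gamma_{n-1}/\gamma_n$ for $n\ge1$, let $p^{(1)}_{n-1}$ be the polynomial part of the formal series $fp_n$ and $\varepsilon_n=fp_n-p^{(1)}_{n-1}$. Assume that the $p_n$ are *generic semi-classical*: formally $Wf'=2Vf+U$ with polynomials $W,V,U$ such that $m=\deg W\ge2$, $\deg V<m$, the zeros $x_1,\dots,x_m$ of $W$ are distinct, and no $\alpha_k=2V(x_k)/W'(x_k)$ is an integer. Define the polynomials $$\Theta_n=W\big(p^{(1)\prime}_{n-1}p_n-p_n'p^{(1)}_{n-1}\big)-2Vp^{(1)}_{n-1}p_n-Up_n^2\quad(n\ge0),$$ $$\Omega_n=a_nW\big(p^{(1)\prime}_{n-1}p_{n-1}-p_n'p^{(1)}_{n-2}\big)-a_nV\big(p^{(1)}_{n-1}p_{n-1}+p_np^{(1)}_{n-2}\big)-a_nUp_np_{n-1}\quad(n\ge1).$$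 **Theorem.** 1. $\deg\Theta_n\le m-2$ and $\deg\Omega_n\le m-1$, and, as formal series, $\Theta_n=W(\varepsilon_np_n'-\varepsilon_n'p_n)+2V\varepsilon_np_n$ and $\Omega_n=a_nW(\varepsilon_{n-1}p_n'-\varepsilon_n'p_{n-1})+a_nV(\varepsilon_{n-1}p_n+\varepsilon_np_{n-1})$. 2. The series $f(z)$ converges for $|z|>\max_k|x_k|$. Let $D\subset\mathbb C\setminus\{x_1,\dots,x_m\}$ be a domain and $z_1\in D$ with $|z_1|>\max_k|x_k|$. Consider on $D$ a holomorphic continuation, again written $f$, of the sum of the series near $z_1$, and a nowhere vanishing holomorphic solution $w$ of $Ww'=2Vw$ (both exist if $D$ is simply connected). Put $\varepsilon_n=fp_n-p^{(1)}_{n-1}$ on $D$. Then for every $n\ge1$ the matrix $$Y=\begin{pmatrix}p_n&\varepsilon_n/w\\p_{n-1}&\varepsilon_{n-1}/w\end{pmatrix}$$ is a fundamental matrix of solutions on $D$ of $$Y'=AY,\qquad A=\frac1W\begin{pmatrix}\Omega_n-V&-a_n\Theta_n\\a_n\Theta_{n-1}&-\Omega_n-V\end{pmatrix}.$$ 3.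 Let $1\le j\le m$, and let $G$ be a simply connected open set that contains $x_j$ and no other $x_k$. There is exactly one holomorphic function $f_j$ on $G$ with $Wf_j'=2Vf_j+U$. For every connected non-empty $S\subset D\cap(G\setminus\{x_j\})$ there is a constant $C_j$ with $f=f_j+C_jw$ on $S$; it does not depend on $n$. For all $n\ge1$ and $z_0\in S$ the monodromy matrix of $Y$ at $x_j$ is $$M_j=\begin{pmatrix}1&C_j(1-e^{-2\pi i\alpha_j})\\0&e^{-2\pi i\alpha_j}\end{pmatrix},$$ that is, along every closed $C^1$ path in $G\setminus\{x_j\}$ that starts at $z_0$ and has winding number $1$ about $x_j$, the system $Z'=AZ$ has a solution with initial value $Z=Y(z_0)$, and every such solution returns to $z_0$ with the value $Y(z_0)M_j$. -/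

import Mathlib

open Polynomial Set Topology

noncomputable section

namespace SemiClassical

/-! ### Formal orthogonal polynomials -/

/-- The linear form on polynomials with moments `μ`, that is `X ^ k ↦ μ k`. -/
def momentForm (μ : ℕ → ℂ) (q : ℂ[X]) : ℂ := q.sum fun k c => c * μ k

/-- `p 0, p 1, …` are the formal orthonormal polynomials of the moment sequence `μ`:
`p n` has exact degree `n` and `⟨p n * p l⟩ = δ`. -/
structure IsFormalOrthonormal (μ : ℕ → ℂ) (p : ℕ → ℂ[X]) : Prop where
  degree_eq : ∀ n : ℕ, (p n).degree = n
  orthonormal : ∀ n l : ℕ, momentForm μ (p n * p l) = if n = l then 1 else 0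

/-- The recurrence coefficient `a_n = γ_{n-1} / γ_n` (`n ≥ 1`), where `γ_n` is the leading
coefficient of `p n`. -/
def recA (p : ℕ → ℂ[X]) (n : ℕ) : ℂ := (p (n - 1)).leadingCoeff / (p n).leadingCoeff

/-! ### Formal series in `1 / z`

A formal series in descending powers of `z` is a Laurent series in the variable `h = 1 / z`. -/

/-- A polynomial in `z`, as a Laurent series in `h = 1 / z`. -/
def toSeries (q : ℂ[X]) : LaurentSeries ℂ := aeval (HahnSeries.single (-1 : ℤ) (1 : ℂ)) q

/-- The derivation `d/dz = - h ^ 2 d/dh` of Laurent series in `h = 1 / z`. -/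
def dz (g : LaurentSeries ℂ) : LaurentSeries ℂ :=
  -(HahnSeries.single (2 : ℤ) (1 : ℂ) * LaurentSeries.derivative ℂ g)

/-- The formal series `f(z) = ∑ μ_k z ^ (-k-1)`. -/
def momentSeries (μ : ℕ → ℂ) : LaurentSeries ℂ :=
  HahnSeries.single (1 : ℤ) (1 : ℂ) * ((PowerSeries.mk μ : PowerSeries ℂ) : LaurentSeries ℂ)

/-- The polynomial part (in `z`) of a Laurent series in `h = 1 / z`. -/
def polyPart (g : LaurentSeries ℂ) : ℂ[X] :=
  ∑ k ∈ Finset.range ((-g.order).toNat + 1), monomial k (g.coeff (-(k : ℤ)))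

/-- The associated polynomial of `q`: the polynomial part of `f q`. For `q = p n` this is the
polynomial written `p_{n-1}^{(1)}`. -/
def assoc (μ : ℕ → ℂ) (q : ℂ[X]) : ℂ[X] := polyPart (momentSeries μ * toSeries q)

/-- The formal function of the second kind `ε_n = f p_n - p_{n-1}^{(1)}`. -/
def epsSeries (μ : ℕ → ℂ) (p : ℕ → ℂ[X]) (n : ℕ) : LaurentSeries ℂ :=
  momentSeries μ * toSeries (p n) - toSeries (assoc μ (p n))

/-- The exponent `α_k = 2 V(x_k) / W'(x_k)` at a zero `c = x_k` of `W`. -/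
def expo (W V : ℂ[X]) (c : ℂ) : ℂ := 2 * V.eval c / (derivative W).eval c

/-- Generic semi-classical data: the formal series of the moments satisfies
`W f' = 2 V f + U`, where `W` has degree `m ≥ 2` with distinct zeros `x 0, …, x (m-1)`,
`deg V < m`, and no exponent `α_k` is an integer. -/
structure IsGeneric (μ : ℕ → ℂ) (W V U : ℂ[X]) {m : ℕ} (x : Fin m → ℂ) : Prop where
  two_le : 2 ≤ m
  degree_W : W.degree = m
  degree_V : V.degree < m
  injective_x : Function.Injective x
  isRoot : ∀ k, W.IsRoot (x k)
  nonint : ∀ k, ∀ i : ℤ, expo W V (x k) ≠ i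
  ode : toSeries W * dz (momentSeries μ) = 2 * toSeries V * momentSeries μ + toSeries U

/-! ### The coefficients of the differential system -/

/-- The polynomial
`Θ_n = W (p_{n-1}^{(1)}' p_n - p_n' p_{n-1}^{(1)}) - 2 V p_{n-1}^{(1)} p_n - U p_n ^ 2`. -/
def Theta (μ : ℕ → ℂ) (W V U : ℂ[X]) (p : ℕ → ℂ[X]) (n : ℕ) : ℂ[X] :=
  W * (derivative (assoc μ (p n)) * p n - derivative (p n) * assoc μ (p n))
    - 2 * V * assoc μ (p n) * p n - U * p n ^ 2

/-- The polynomial `Ω_n` (`n ≥ 1`), equal to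
`a_n W (p_{n-1}^{(1)}' p_{n-1} - p_n' p_{n-2}^{(1)})
  - a_n V (p_{n-1}^{(1)} p_{n-1} + p_n p_{n-2}^{(1)}) - a_n U p_n p_{n-1}`. -/
def Omega (μ : ℕ → ℂ) (W V U : ℂ[X]) (p : ℕ → ℂ[X]) (n : ℕ) : ℂ[X] :=
  C (recA p n) *
    (W * (derivative (assoc μ (p n)) * p (n - 1) - derivative (p n) * assoc μ (p (n - 1)))
      - V * (assoc μ (p n) * p (n - 1) + p n * assoc μ (p (n - 1)))
      - U * p n * p (n - 1))

/-- The coefficient matrix of the differential system `Y' = A Y`. -/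
def coeffA (μ : ℕ → ℂ) (W V U : ℂ[X]) (p : ℕ → ℂ[X]) (n : ℕ) (z : ℂ) :
    Matrix (Fin 2) (Fin 2) ℂ :=
  (W.eval z)⁻¹ •
    !![(Omega μ W V U p n).eval z - V.eval z, -recA p n * (Theta μ W V U p n).eval z;
       recA p n * (Theta μ W V U p (n - 1)).eval z, -(Omega μ W V U p n).eval z - V.eval z]

/-! ### Branches of `f` and `w` outside of cuts -/

/-- `D` is a domain that avoids the singular points; on it, `f` is a holomorphic function which is
the analytic continuation of the sum of the series `∑ μ_k z ^ (-k-1)` near the point `z₁`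
of `D`, with `|z₁| > max |x_k|`; and `w` is a branch on `D` of the (generalized Jacobi) weight, a
nowhere vanishing holomorphic solution of `W w' = 2 V w`. -/
structure IsBranch (μ : ℕ → ℂ) (W V : ℂ[X]) {m : ℕ} (x : Fin m → ℂ)
    (D : Set ℂ) (z₁ : ℂ) (f w : ℂ → ℂ) : Prop where
  isOpen : IsOpen D
  isConnected : IsConnected D
  avoids : ∀ k, x k ∉ D
  mem : z₁ ∈ D
  large : ∀ k, ‖x k‖ < ‖z₁‖
  holo_f : DifferentiableOn ℂ f D
  germ_f : ∀ᶠ z in 𝓝 z₁, HasSum (fun k : ℕ => μ k * z⁻¹ ^ (k + 1)) (f z)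
  holo_w : DifferentiableOn ℂ w D
  ode_w : ∀ z ∈ D, W.eval z * deriv w z = 2 * V.eval z * w z
  ne_zero_w : ∀ z ∈ D, w z ≠ 0

/-- The function `ε_n = f p_n - p_{n-1}^{(1)}` for a branch of `f`. -/
def epsFun (μ : ℕ → ℂ) (p : ℕ → ℂ[X]) (f : ℂ → ℂ) (n : ℕ) (z : ℂ) : ℂ :=
  f z * (p n).eval z - (assoc μ (p n)).eval z

/-- The matrix with rows `(p_n, ε_n / w)` and `(p_{n-1}, ε_{n-1} / w)`. -/
def matY (μ : ℕ → ℂ) (p : ℕ → ℂ[X]) (f w : ℂ → ℂ) (n : ℕ) (z : ℂ) : Matrix (Fin 2) (Fin 2) ℂ :=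
  !![(p n).eval z, epsFun μ p f n z / w z;
     (p (n - 1)).eval z, epsFun μ p f (n - 1) z / w z]

/-! ### Monodromy -/

/-- `γ : [0, 1] → G \ {c}` is a closed `C¹` path based at `z₀`, with winding number `1`
about `c`. -/
structure IsContourAbout (G : Set ℂ) (c z₀ : ℂ) (γ : ℝ → ℂ) : Prop where
  smooth : ContDiffOn ℝ 1 γ (Icc 0 1)
  start : γ 0 = z₀
  finish : γ 1 = z₀
  mapsTo : ∀ t ∈ Icc (0 : ℝ) 1, γ t ∈ G \ {c}
  winding : ∫ t in (0 : ℝ)..1, derivWithin γ (Icc 0 1) t / (γ t - c) = 2 * Real.pi * Complex.I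

/-- `Z t` (`0 ≤ t ≤ 1`) is a matrix solution of `Z' = A Z` along the path `γ`. -/
def IsSolutionAlong (A : ℂ → Matrix (Fin 2) (Fin 2) ℂ) (γ : ℝ → ℂ)
    (Z : ℝ → Matrix (Fin 2) (Fin 2) ℂ) : Prop :=
  ∀ t ∈ Icc (0 : ℝ) 1, ∀ i k, HasDerivWithinAt (fun s => Z s i k)
    (derivWithin γ (Icc 0 1) t * (A (γ t) * Z t) i k) (Icc 0 1) t

/-- `M` is the monodromy matrix about `c` of the solution `Y` of `Y' = A Y` given near `z₀`: when
`z` follows, from `z₀`, any contour in `G` about `c`, the equation `Z' = A Z` is solvable along it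
with the initial value `Y z₀`, and every such solution comes back with the value `Y z₀ * M`. -/
def IsMonodromyAt (A Y : ℂ → Matrix (Fin 2) (Fin 2) ℂ) (G : Set ℂ) (c z₀ : ℂ)
    (M : Matrix (Fin 2) (Fin 2) ℂ) : Prop :=
  ∀ γ : ℝ → ℂ, IsContourAbout G c z₀ γ →
    (∃ Z, IsSolutionAlong A γ Z ∧ Z 0 = Y z₀) ∧
    ∀ Z, IsSolutionAlong A γ Z → Z 0 = Y z₀ → Z 1 = Y z₀ * M

/-- The matrix with rows `(1, K (1 - exp (-2πiα)))` and `(0, exp (-2πiα))`. -/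
def monodromyMatrix (K α : ℂ) : Matrix (Fin 2) (Fin 2) ℂ :=
  !![1, K * (1 - Complex.exp (-2 * Real.pi * Complex.I * α));
     0, Complex.exp (-2 * Real.pi * Complex.I * α)]

/-- `g` is a holomorphic solution of `W g' = 2 V g + U` on the open set `G`. -/
def IsHoloSolution (W V U : ℂ[X]) (G : Set ℂ) (g : ℂ → ℂ) : Prop :=
  DifferentiableOn ℂ g G ∧ ∀ z ∈ G, W.eval z * deriv g z = 2 * V.eval z * g z + U.eval z

end SemiClassical

end

open SemiClassical

/-! Part 1 is a count of orders at infinity. Orthonormality means that `ε_n` has order exactly `n +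
1` in `1 / z`. Writing the associated polynomial as `f p_n - ε_n`, the equation `W f' = 2 V f + U`
eliminates `f` from `Θ_n` and `Ω_n`, and the degrees can be read off. The same count yields the
Casorati identity (`casorati`). This identity and its derivative give, by polynomial algebra alone,
the differential systems for the `p_n` and for their associated polynomials (`system_fst`,
`assoc_fst` and their companions).

For part 2, the equation becomes a recursion in the variable `h = 1 / z` in which `(k + 1) μ_k` is a
convolution of moments with convergent coefficients; the factor `k + 1` wins, so `μ_k h ^ k` is
bounded (`exists_bound_of_formal_solution`). The sum solves the differential equation, the identity
theorem carries this over to `D`, and the two polynomial systems combine into `Y' = A Y`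
(`hasDerivWithinAt_matY`). The determinant of `Y` is `1 / (a_n w)`.

For part 3, two solutions of the inhomogeneous equation differ locally by a constant times `w`. At
the simple zero `x_j` the equation reduces to `(z - c) u' = α u + g`, which a finite correction and
a Picard iteration solve on all of `G` (`exists_solution_singular`); a comparison of leading terms
gives uniqueness (`isHoloSolution_zero_eq`). Along a contour `f_j` returns to its value while `w` is
multiplied by `exp (2πiα_j)`; inserting `f = f_j + C_j w` into `Y` gives `M_j` (`isMonodromyAt`). -/

/-! ### Primitives on simply connected domains -/

/-- The complex numbers with the discrete topology. -/
def DiscreteComplex : Type := ℂ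

instance : TopologicalSpace DiscreteComplex := ⊥

instance : DiscreteTopology DiscreteComplex := ⟨rfl⟩

/-- The covering space of the germs of primitives that is given by compatible local primitives `F i`,
with locally constant differences, on an open cover `b` of `U`. -/
noncomputable def primitiveCore {U : Set ℂ} (b : U → Set ℂ) (hb : ∀ i, IsOpen (b i))
    (hmem : ∀ i : U, (i : ℂ) ∈ b i) (F : U → ℂ → ℂ)
    (hF : ∀ i j, ∀ t : Set ℂ, IsOpen ((b i ∩ b j) ∩ (fun z => F i z - F j z) ⁻¹' t)) :
    FiberBundleCore U U DiscreteComplex where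
  baseSet i := Subtype.val ⁻¹' b i
  isOpen_baseSet i := (hb i).preimage continuous_subtype_val
  indexAt := id
  mem_baseSet_at i := hmem i
  coordChange i j z v := (show ℂ from v) + (F i z - F j z)
  coordChange_self i z _ v := by
    change (show ℂ from v) + _ = _
    rw [sub_self, add_zero]
  continuousOn_coordChange i j := by
    rintro ⟨z, v⟩ ⟨hz, -⟩
    -- The fibre is discrete, so continuity means local constancy; it holds because the transition
    -- constants `F i - F j` are locally constant.
    refine (ContinuousAt.congr (f := fun _ => (show DiscreteComplex from
      (show ℂ from v) + (F i z - F j z))) continuousAt_const ?_).continuousWithinAt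
    have h1 : Subtype.val ⁻¹' ((b i ∩ b j) ∩ (fun z => F i z - F j z) ⁻¹' {F i z - F j z})
        ∈ 𝓝 z :=
      ((hF i j _).preimage continuous_subtype_val).mem_nhds ⟨hz, rfl⟩
    have h2 : ({v} : Set DiscreteComplex) ∈ 𝓝 v := (isOpen_discrete _).mem_nhds rfl
    filter_upwards [prod_mem_nhds h1 h2]
    rintro ⟨y, u⟩ ⟨hy, rfl⟩
    exact congrArg (fun t => (show ℂ from u) + t) hy.2.symm
  coordChange_comp i j k z _ v := by
    change (show ℂ from v) + _ + _ = (show ℂ from v) + _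
    ring

/-- Disks have primitives, and two of them differ by locally constant functions, so germs of
primitives form a covering with fibre `ℂ`. Over a simply connected base the identity lifts to a
global section, which chooses the additive constants consistently. -/
theorem exists_primitive {U : Set ℂ} (hU : IsOpen U) (hs : IsSimplyConnected U) {f : ℂ → ℂ}
    (hf : DifferentiableOn ℂ f U) : ∃ F : ℂ → ℂ, ∀ z ∈ U, HasDerivAt F (f z) z := by
  classical
  have hloc : ∀ i : U, ∃ r > 0, ∃ F : ℂ → ℂ, Metric.ball (i : ℂ) r ⊆ U ∧
      ∀ z ∈ Metric.ball (i : ℂ) r, HasDerivAt F (f z) z := by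
    intro i
    obtain ⟨r, hr, hrU⟩ := Metric.isOpen_iff.mp hU i i.2
    obtain ⟨F, hF⟩ := (hf.mono hrU).isExactOn_ball
    exact ⟨r, hr, F, hrU, hF⟩
  choose r hr F hrU hF using hloc
  set b : U → Set ℂ := fun i => Metric.ball (i : ℂ) (r i) with hbdef
  have hbo : ∀ i, IsOpen (b i) := fun i => Metric.isOpen_ball
  have hmem : ∀ i : U, (i : ℂ) ∈ b i := fun i => Metric.mem_ball_self (hr i)
  have hFF : ∀ i j, ∀ t : Set ℂ, IsOpen ((b i ∩ b j) ∩ (fun z => F i z - F j z) ⁻¹' t) := by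
    intro i j t
    have hd : ∀ z ∈ b i ∩ b j, HasDerivAt (fun z => F i z - F j z) 0 z := by
      intro z hz
      simpa only [sub_self] using (hF i z hz.1).fun_sub (hF j z hz.2)
    exact ((hbo i).inter (hbo j)).isOpen_inter_preimage_of_deriv_eq_zero
      (fun z hz => (hd z hz).differentiableAt.differentiableWithinAt)
      (fun z hz => (hd z hz).deriv) t
  have := hs.simplyConnectedSpace
  have := hU.locallyPathConnectedSpace
  obtain ⟨z₀, hz₀⟩ := hs.nonempty
  set Z := primitiveCore b hbo hmem F hFF with hZ
  have hcov : IsCoveringMap (Bundle.TotalSpace.proj : Bundle.TotalSpace DiscreteComplex Z.Fiber → U) :=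
    FiberBundle.isCoveringMap
  obtain ⟨s, ⟨-, hsec⟩, -⟩ := hcov.existsUnique_continuousMap_lifts
    (ContinuousMap.id U) ⟨z₀, hz₀⟩ ⟨⟨z₀, hz₀⟩, (show DiscreteComplex from (0 : ℂ))⟩ rfl
  have hsec' : ∀ z : U, (s z).1 = z := fun z => congrFun hsec z
  let P : U → ℂ := fun z => (show ℂ from (s z).2) + F (s z).1 z
  refine ⟨fun z => if hz : z ∈ U then P ⟨z, hz⟩ else 0, fun z hz => ?_⟩
  let i : U := ⟨z, hz⟩
  have hsi : s i ∈ (Z.localTriv i).source := by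
    rw [FiberBundleCore.mem_localTriv_source, hsec']
    exact hmem i
  have hcont : ContinuousAt (fun y => (Z.localTriv i (s y)).2) i :=
    continuous_snd.continuousAt.comp
      (((Z.localTriv i).continuousAt hsi).comp s.continuous.continuousAt)
  -- In the trivialization at `i` the section is locally constant, so near `i` the glued function is
  -- `F i` plus a fixed constant.
  have hev : ∀ᶠ y in 𝓝 i, (Z.localTriv i (s y)).2 = (Z.localTriv i (s i)).2 :=
    hcont ((isOpen_discrete ({(Z.localTriv i (s i)).2} : Set DiscreteComplex)).mem_nhds rfl)
  set v : ℂ := (show ℂ from (Z.localTriv i (s i)).2) with hv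
  have hPv : ∀ᶠ y in 𝓝 i, P y = v + F i y := by
    filter_upwards [hev] with y hy
    have h1 : (show ℂ from (s y).2) + (F (s y).1 (s y).1 - F i (s y).1) = v := hy
    rw [← h1]
    simp only [P]
    rw [hsec']
    have aux : ∀ a b c : ℂ, a + b = a + (b - c) + c := fun a b c => by ring
    exact aux _ _ _
  have hnh : ∀ᶠ y in 𝓝 z, (if hz : y ∈ U then P ⟨y, hz⟩ else 0) = v + F i y := by
    have := (hU.isOpenEmbedding_subtypeVal.map_nhds_eq i)
    change ∀ᶠ y in 𝓝 (i : ℂ), _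
    rw [← this, Filter.eventually_map]
    filter_upwards [hPv] with y hy
    rw [dif_pos y.2, hy]
  refine HasDerivAt.congr_of_eventuallyEq ?_ hnh
  exact (hF i z (hmem i)).const_add v

/-! ### The singular equation `(z - c) u' = α u + g` on simply connected domains -/

/-- Integrating along the segment from `c` to `z` gains the factor `1 / (k + 1)`, which will make
the Picard iteration contract. The bound on `h'` is asked only off `c`, where a divided difference
is a genuine quotient. -/
theorem norm_le_pow_of_deriv_norm_le {h h' : ℂ → ℂ} {c : ℂ} {r K : ℝ} {k : ℕ}
    (hd : ∀ z ∈ Metric.ball c r, HasDerivAt h (h' z) z) (h0 : h c = 0)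
    (hb : ∀ z ∈ Metric.ball c r, z ≠ c → ‖h' z‖ ≤ K * ‖z - c‖ ^ k)
    (hc : ContinuousAt h' c) {z : ℂ} (hz : z ∈ Metric.ball c r) :
    ‖h z‖ ≤ K / (k + 1) * ‖z - c‖ ^ (k + 1) := by
  have hr : 0 < r := dist_nonneg.trans_lt hz
  have hb' : ∀ y ∈ Metric.ball c r, ‖h' y‖ ≤ K * ‖y - c‖ ^ k := by
    intro y hy
    by_cases hyc : y = c
    · subst hyc
      have h1 : Filter.Tendsto (fun t => ‖h' t‖) (𝓝[≠] y) (𝓝 ‖h' y‖) :=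
        (hc.norm.tendsto).mono_left nhdsWithin_le_nhds
      have h2 : Filter.Tendsto (fun t => K * ‖t - y‖ ^ k) (𝓝[≠] y) (𝓝 (K * ‖y - y‖ ^ k)) := by
        have : ContinuousAt (fun t => K * ‖t - y‖ ^ k) y := by fun_prop
        exact this.tendsto.mono_left nhdsWithin_le_nhds
      refine le_of_tendsto_of_tendsto h1 h2 ?_
      filter_upwards [self_mem_nhdsWithin,
        mem_nhdsWithin_of_mem_nhds (Metric.ball_mem_nhds y hr)] with t ht1 ht2
      exact hb t ht2 ht1
    · exact hb y hy hyc
  set ρ := ‖z - c‖ with hρ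
  have hmem : ∀ t ∈ Icc (0 : ℝ) 1, c + t * (z - c) ∈ Metric.ball c r := by
    intro t ht
    rw [Metric.mem_ball, dist_eq_norm] at hz ⊢
    rw [add_sub_cancel_left, norm_mul, Complex.norm_real, Real.norm_of_nonneg ht.1]
    nlinarith [ht.1, ht.2, norm_nonneg (z - c)]
  have hder : ∀ t ∈ Icc (0 : ℝ) 1,
      HasDerivAt (fun s : ℝ => h (c + s * (z - c))) (h' (c + t * (z - c)) * (z - c)) t := by
    intro t ht
    have h1 : HasDerivAt (fun s : ℝ => c + (s : ℂ) * (z - c)) (z - c) t := by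
      simpa using ((Complex.ofRealCLM.hasDerivAt (x := t)).mul_const (z - c)).const_add c
    exact (hd _ (hmem t ht)).comp t h1
  have hB : ∀ t : ℝ, HasDerivAt (fun s : ℝ => K / (k + 1) * ρ ^ (k + 1) * s ^ (k + 1))
      (K * ρ ^ (k + 1) * t ^ k) t := by
    intro t
    have hk : (k : ℝ) + 1 ≠ 0 := by positivity
    have := (hasDerivAt_pow (k + 1) t).const_mul (K / (k + 1) * ρ ^ (k + 1))
    refine this.congr_deriv ?_
    push_cast
    field_simp
  have key := image_norm_le_of_norm_deriv_right_le_deriv_boundary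
    (f := fun s : ℝ => h (c + s * (z - c))) (a := 0) (b := 1)
    (fun t ht => (hder t ht).continuousAt.continuousWithinAt)
    (fun t ht => (hder t ⟨ht.1, ht.2.le⟩).hasDerivWithinAt) (B := _) (B' := _)
    (by simp [h0]) hB ?_ (right_mem_Icc.mpr zero_le_one)
  · simpa using key
  · intro t ht
    have h1 := hb' _ (hmem t ⟨ht.1, ht.2.le⟩)
    rw [add_sub_cancel_left, norm_mul, Complex.norm_real, Real.norm_of_nonneg ht.1,
      mul_pow] at h1
    rw [norm_mul]
    calc _ ≤ K * (t ^ k * ρ ^ k) * ρ := mul_le_mul_of_nonneg_right h1 (norm_nonneg _)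
      _ = _ := by ring

section Picard

variable {G : Set ℂ} {c α : ℂ} {g : ℂ → ℂ} {N : ℕ} {d : ℕ → ℂ → ℂ}

/-- The functions `d n` are the successive Picard corrections. Dividing by `z - c` and integrating
restores the order `N + 1` and costs a factor `‖α‖ / (N + 1) ≤ 1 / 2`. -/
theorem picard_bound_near_centre {r M : ℝ} (hr : Metric.ball c r ⊆ G) (hN : 2 * ‖α‖ ≤ N + 1)
    (hd0 : ∀ z ∈ G, HasDerivAt (d 0) ((z - c) ^ N * g z) z)
    (hd : ∀ n, ∀ z ∈ G, HasDerivAt (d (n + 1)) (α * dslope (d n) c z) z)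
    (hc : ∀ n, d n c = 0) (hG : IsOpen G) (hcG : c ∈ G) (hg : ContinuousOn g G)
    (hM : ∀ z ∈ Metric.ball c r, ‖g z‖ ≤ M) (n : ℕ) {z : ℂ} (hz : z ∈ Metric.ball c r) :
    ‖d n z‖ ≤ M * (1 / 2) ^ n * ‖z - c‖ ^ (N + 1) := by
  have hM0 : 0 ≤ M := (norm_nonneg _).trans (hM z hz)
  induction n generalizing z with
  | zero =>
    have h1 := norm_le_pow_of_deriv_norm_le (h := d 0) (K := M) (k := N)
      (fun y hy => hd0 y (hr hy)) (hc 0) (fun y hy _ => by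
        rw [norm_mul, norm_pow, mul_comm]
        exact mul_le_mul_of_nonneg_right (hM y hy) (by positivity))
      (by
        have := hg.continuousAt (hG.mem_nhds hcG)
        fun_prop) hz
    refine h1.trans ?_
    have : M / (N + 1) ≤ M := div_le_self hM0 (by linarith [N.cast_nonneg (α := ℝ)])
    simpa using mul_le_mul_of_nonneg_right this (by positivity)
  | succ n ih =>
    have hdiff : ContinuousAt (dslope (d n) c) c := by
      rw [continuousAt_dslope_same]
      cases n with
      | zero => exact (hd0 c hcG).differentiableAt
      | succ n => exact (hd n c hcG).differentiableAt
    have h1 := norm_le_pow_of_deriv_norm_le (h := d (n + 1)) (K := ‖α‖ * (M * (1 / 2) ^ n))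
      (k := N) (fun y hy => hd n y (hr hy)) (hc _) (fun y hy hyc => by
        have h2 := ih hy
        have hpos : 0 < ‖y - c‖ := norm_pos_iff.mpr (sub_ne_zero.mpr hyc)
        rw [dslope_of_ne _ hyc, slope_def_field, hc n, sub_zero, norm_mul, norm_div, mul_assoc]
        refine mul_le_mul_of_nonneg_left ?_ (norm_nonneg _)
        rw [div_le_iff₀ hpos]
        refine h2.trans (le_of_eq ?_)
        ring) (by fun_prop) hz
    refine h1.trans (mul_le_mul_of_nonneg_right ?_ (by positivity))
    rw [div_le_iff₀ (by positivity), pow_succ]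
    have : 0 ≤ M * (1 / 2) ^ n := by positivity
    nlinarith

/-- The geometric bound spreads from `c` over the connected set `G`: the points with such a bound
near them form a set that is open and relatively closed. At a point other than `c` the kernel `α /
(z - c)` is bounded, and a small enough disk gives the contraction. -/
theorem picard_bound (hG : IsOpen G) (hGc : IsPreconnected G) (hcG : c ∈ G)
    (hN : 2 * ‖α‖ ≤ N + 1) (hg : ContinuousOn g G)
    (hd0 : ∀ z ∈ G, HasDerivAt (d 0) ((z - c) ^ N * g z) z)
    (hd : ∀ n, ∀ z ∈ G, HasDerivAt (d (n + 1)) (α * dslope (d n) c z) z)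
    (hc : ∀ n, d n c = 0) {z : ℂ} (hz : z ∈ G) :
    ∃ C : ℝ, ∀ᶠ y in 𝓝 z, ∀ n, ‖d n y‖ ≤ C * (1 / 2) ^ n := by
  set u : Set ℂ := {z | ∃ C : ℝ, ∀ᶠ y in 𝓝 z, ∀ n, ‖d n y‖ ≤ C * (1 / 2) ^ n} with hu
  have huo : IsOpen u := by
    rw [isOpen_iff_eventually]
    rintro y ⟨C, hC⟩
    filter_upwards [eventually_eventually_nhds.mpr hC] with t ht
    exact ⟨C, ht⟩
  have hcu : c ∈ u := by
    obtain ⟨r, hr, hrG⟩ := Metric.nhds_basis_closedBall.mem_iff.mp (hG.mem_nhds hcG)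
    obtain ⟨M, hM⟩ := (isCompact_closedBall c r).exists_bound_of_continuousOn (hg.mono hrG)
    have hM0 : 0 ≤ M := (norm_nonneg _).trans (hM c (Metric.mem_closedBall_self hr.le))
    refine ⟨M * r ^ (N + 1), ?_⟩
    filter_upwards [Metric.ball_mem_nhds c hr] with y hy n
    have h1 := picard_bound_near_centre (Metric.ball_subset_closedBall.trans hrG) hN hd0 hd hc hG
      hcG hg (fun t ht => hM t (Metric.ball_subset_closedBall ht)) n hy
    have h2 : ‖y - c‖ ^ (N + 1) ≤ r ^ (N + 1) :=
      pow_le_pow_left₀ (norm_nonneg _) (mem_ball_iff_norm.mp hy).le _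
    calc _ ≤ _ := h1
      _ ≤ M * (1 / 2) ^ n * r ^ (N + 1) := mul_le_mul_of_nonneg_left h2 (by positivity)
      _ = _ := by ring
  refine hGc.subset_of_closure_inter_subset huo ⟨c, hcG, hcu⟩ ?_ hz
  rintro a ⟨hau, haG⟩
  by_cases hac : a = c
  · rwa [hac]
  obtain ⟨R, hR, hRG⟩ := Metric.nhds_basis_closedBall.mem_iff.mp (hG.mem_nhds haG)
  have hδ : 0 < ‖a - c‖ := norm_pos_iff.mpr (sub_ne_zero.mpr hac)
  -- `K` bounds `α / (s - c)` on the disk of radius `ρ` about `a`, which stays at distance `‖a - c‖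
  -- / 2` from `c`; the last term in `ρ` ensures `2 ρ K ≤ 1 / 4`.
  set K := ‖α‖ / (‖a - c‖ / 2) with hK
  have hK0 : 0 ≤ K := by positivity
  set ρ := min (min R (‖a - c‖ / 2)) (1 / (8 * (K + 1))) with hρ
  have hρ0 : 0 < ρ := by positivity
  have hρR : ρ ≤ R := (min_le_left _ _).trans (min_le_left _ _)
  have hρδ : ρ ≤ ‖a - c‖ / 2 := (min_le_left _ _).trans (min_le_right _ _)
  have hρK : K * (2 * ρ) ≤ 1 / 4 := by
    have h1 : ρ ≤ 1 / (8 * (K + 1)) := min_le_right _ _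
    rw [le_div_iff₀ (by positivity)] at h1
    nlinarith
  have hball : Metric.closedBall a ρ ⊆ G := (Metric.closedBall_subset_closedBall hρR).trans hRG
  have hfar : ∀ y ∈ Metric.closedBall a ρ, ‖a - c‖ / 2 ≤ ‖y - c‖ := by
    intro y hy
    have h1 : ‖a - c‖ ≤ ‖y - a‖ + ‖y - c‖ := by
      rw [norm_sub_rev y a]
      simpa using norm_add_le (a - y) (y - c)
    have h2 : ‖y - a‖ ≤ ρ := mem_closedBall_iff_norm.mp hy
    linarith
  obtain ⟨y, hyu, hya⟩ := Metric.mem_closure_iff.mp hau ρ hρ0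
  rw [dist_comm] at hya
  have hyb : y ∈ Metric.closedBall a ρ := Metric.ball_subset_closedBall hya
  obtain ⟨C, hC⟩ := hyu
  have hCy := hC.self_of_nhds
  have hcont : ContinuousOn (d 0) G := fun t ht => (hd0 t ht).continuousAt.continuousWithinAt
  obtain ⟨S, hS⟩ := (isCompact_closedBall a ρ).exists_bound_of_continuousOn (hcont.mono hball)
  -- The value at the good point `y` and the increment from `y` each cost at most a quarter of the
  -- previous bound, the former thanks to the factor 2 in `2 * C`; `S` serves `n = 0`.
  have key : ∀ n, ∀ t ∈ Metric.closedBall a ρ, ‖d n t‖ ≤ max (2 * C) S * (1 / 2) ^ n := by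
    intro n
    induction n with
    | zero =>
      intro t ht
      simpa using Or.inr (hS t ht)
    | succ n ih =>
      intro t ht
      set C' := max (2 * C) S * (1 / 2) ^ n with hC'
      have h1 : ‖d (n + 1) t - d (n + 1) y‖ ≤ K * C' * ‖t - y‖ := by
        refine Convex.norm_image_sub_le_of_norm_hasDerivWithin_le
          (fun s hs => (hd n s (hball hs)).hasDerivWithinAt) ?_ (convex_closedBall a ρ) hyb ht
        intro s hs
        have hsc : 0 < ‖s - c‖ := (half_pos hδ).trans_le (hfar s hs)
        have hsc' : s ≠ c := by
          rintro rfl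
          simp at hsc
        rw [dslope_of_ne _ hsc', slope_def_field, hc n, sub_zero, norm_mul, norm_div, hK,
          ← mul_div_assoc, div_mul_eq_mul_div]
        exact div_le_div₀ (mul_nonneg (norm_nonneg _) ((norm_nonneg _).trans (ih s hs)))
          (mul_le_mul_of_nonneg_left (ih s hs) (norm_nonneg _)) (half_pos hδ) (hfar s hs)
      have h2 : ‖t - y‖ ≤ 2 * ρ := by
        have := mem_closedBall_iff_norm.mp ht
        have := mem_closedBall_iff_norm.mp hyb
        rw [norm_sub_rev] at this
        have h3 := norm_add_le (t - a) (a - y)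
        rw [sub_add_sub_cancel] at h3
        linarith
      have hC'0 : 0 ≤ C' := (norm_nonneg _).trans (ih t ht)
      have h4 : K * C' * ‖t - y‖ ≤ C' / 4 := by
        calc K * C' * ‖t - y‖ ≤ K * C' * (2 * ρ) :=
              mul_le_mul_of_nonneg_left h2 (mul_nonneg hK0 hC'0)
          _ = C' * (K * (2 * ρ)) := by ring
          _ ≤ C' * (1 / 4) := mul_le_mul_of_nonneg_left hρK hC'0
          _ = C' / 4 := by ring
      have h5 : C * (1 / 2) ^ (n + 1) ≤ C' / 4 := by
        have : 2 * C * (1 / 2) ^ n ≤ C' :=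
          mul_le_mul_of_nonneg_right (le_max_left _ _) (by positivity)
        rw [pow_succ]
        linarith
      have h6 := norm_le_norm_add_norm_sub' (d (n + 1) t) (d (n + 1) y)
      have h7 := hCy (n + 1)
      have : max (2 * C) S * (1 / 2) ^ (n + 1) = C' / 2 := by rw [hC', pow_succ]; ring
      rw [this]
      linarith
  refine ⟨max (2 * C) S, ?_⟩
  filter_upwards [Metric.closedBall_mem_nhds a hρ0] with t ht n
  exact key n t ht

end Picard

/-- The solution is the sum of the Picard corrections: `(z - c) d_{n+1}' = α d_n`, and `d_0`
contributes the inhomogeneous term. The locally uniform geometric bound permits termwise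
differentiation. -/
theorem exists_solution_of_high_order {G : Set ℂ} (hG : IsOpen G) (hGs : IsSimplyConnected G)
    {c α : ℂ} (hcG : c ∈ G) {g : ℂ → ℂ} (hg : DifferentiableOn ℂ g G) {N : ℕ}
    (hN : 2 * ‖α‖ ≤ N + 1) : ∃ u : ℂ → ℂ, DifferentiableOn ℂ u G ∧
      ∀ z ∈ G, (z - c) * deriv u z = α * u z + (z - c) ^ (N + 1) * g z := by
  -- Primitives are normalized to vanish at `c`, so that the next divided difference is the quotient
  -- by `z - c`. Stating this for arbitrary `h` lets the iteration be defined before its holomorphy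
  -- is known.
  have hprim : ∀ h : ℂ → ℂ, ∃ P : ℂ → ℂ, DifferentiableOn ℂ h G →
      P c = 0 ∧ ∀ z ∈ G, HasDerivAt P (h z) z := by
    intro h
    by_cases hh : DifferentiableOn ℂ h G
    · obtain ⟨P, hP⟩ := exists_primitive hG hGs hh
      exact ⟨fun z => P z - P c, fun _ => ⟨sub_self _, fun z hz => (hP z hz).sub_const _⟩⟩
    · exact ⟨0, fun h' => absurd h' hh⟩
  choose P hP using hprim
  let d : ℕ → ℂ → ℂ := fun n => Nat.rec (P fun z => (z - c) ^ N * g z)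
    (fun _ h => P fun z => α * dslope h c z) n
  have hfirst : DifferentiableOn ℂ (fun z => (z - c) ^ N * g z) G := by fun_prop
  have hdo : ∀ n, DifferentiableOn ℂ (d n) G := by
    intro n
    induction n with
    | zero => exact fun z hz => ((hP _ hfirst).2 z hz).differentiableAt.differentiableWithinAt
    | succ n ih =>
      have h1 : DifferentiableOn ℂ (fun z => α * dslope (d n) c z) G :=
        ((Complex.differentiableOn_dslope (hG.mem_nhds hcG)).mpr ih).const_mul α
      exact fun z hz => ((hP _ h1).2 z hz).differentiableAt.differentiableWithinAt
  have hstep : ∀ n, DifferentiableOn ℂ (fun z => α * dslope (d n) c z) G := fun n =>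
    ((Complex.differentiableOn_dslope (hG.mem_nhds hcG)).mpr (hdo n)).const_mul α
  have hd0 : ∀ z ∈ G, HasDerivAt (d 0) ((z - c) ^ N * g z) z := (hP _ hfirst).2
  have hd : ∀ n, ∀ z ∈ G, HasDerivAt (d (n + 1)) (α * dslope (d n) c z) z :=
    fun n => (hP _ (hstep n)).2
  have hc : ∀ n, d n c = 0 := by
    intro n
    cases n with
    | zero => exact (hP _ hfirst).1
    | succ n => exact (hP _ (hstep n)).1
  have hloc : ∀ z ∈ G, DifferentiableAt ℂ (fun w => ∑' n, d n w) z ∧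
      Summable (fun n => d n z) ∧
      HasSum (fun n => deriv (d n) z) (deriv (fun w => ∑' n, d n w) z) := by
    intro z hz
    obtain ⟨C, hC⟩ := picard_bound hG hGs.isPathConnected.isConnected.isPreconnected hcG hN
      hg.continuousOn hd0 hd hc hz
    obtain ⟨O, hO, hOo, hzO⟩ := mem_nhds_iff.mp (Filter.inter_mem hC (hG.mem_nhds hz))
    have hsum : Summable fun n : ℕ => C * (1 / 2 : ℝ) ^ n :=
      summable_geometric_two.mul_left C
    have hdO : ∀ n, DifferentiableOn ℂ (d n) O := fun n =>
      (hdo n).mono fun y hy => (hO hy).2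
    have hbO : ∀ n, ∀ w ∈ O, ‖d n w‖ ≤ C * (1 / 2) ^ n := fun n w hw => (hO hw).1 n
    exact ⟨(Complex.differentiableOn_tsum_of_summable_norm hsum hdO hOo hbO).differentiableAt
      (hOo.mem_nhds hzO), Summable.of_norm_bounded hsum fun n => hbO n z hzO,
      Complex.hasSum_deriv_of_summable_norm hsum hdO hOo hbO hzO⟩
  refine ⟨fun w => ∑' n, d n w, fun z hz => (hloc z hz).1.differentiableWithinAt, fun z hz => ?_⟩
  obtain ⟨-, hs, hds⟩ := hloc z hz
  have h1 : HasSum (fun n => (z - c) * deriv (d (n + 1)) z) (α * ∑' n, d n z) := by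
    refine (hs.hasSum.mul_left α).congr_fun fun n => ?_
    rw [(hd n z hz).deriv]
    have := sub_smul_dslope (d n) c z
    rw [smul_eq_mul, hc n, sub_zero] at this
    rw [mul_left_comm, this]
  have h2 := HasSum.zero_add (f := fun n => (z - c) * deriv (d n) z) h1
  rw [(hds.mul_left (z - c)).unique h2, (hd0 z hz).deriv, pow_succ]
  ring

/-- Lower-order terms of the right side are removed one by one: since `α ≠ k`, a multiple of `(z -
c) ^ k` absorbs the leading term `g c (z - c) ^ k`. What remains has order `k + 1`, until the order
is high enough for the iteration. -/
theorem exists_solution_singular {G : Set ℂ} (hG : IsOpen G) (hGs : IsSimplyConnected G)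
    {c α : ℂ} (hcG : c ∈ G) (hα : ∀ n : ℕ, α ≠ n) {g : ℂ → ℂ} (hg : DifferentiableOn ℂ g G) :
    ∃ u : ℂ → ℂ, DifferentiableOn ℂ u G ∧
      ∀ z ∈ G, (z - c) * deriv u z = α * u z + g z := by
  obtain ⟨N, hN⟩ := exists_nat_ge (2 * ‖α‖)
  have key : ∀ j k : ℕ, k + j = N + 1 → ∀ g : ℂ → ℂ, DifferentiableOn ℂ g G →
      ∃ u : ℂ → ℂ, DifferentiableOn ℂ u G ∧
      ∀ z ∈ G, (z - c) * deriv u z = α * u z + (z - c) ^ k * g z := by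
    intro j
    induction j with
    | zero =>
      intro k hk g hg
      obtain rfl : k = N + 1 := hk
      exact exists_solution_of_high_order hG hGs hcG hg (by linarith)
    | succ j ih =>
      intro k hk g hg
      obtain ⟨u, hu, hue⟩ := ih (k + 1) (by omega) _
        ((Complex.differentiableOn_dslope (hG.mem_nhds hcG)).mpr hg)
      have hk0 : (k : ℂ) - α ≠ 0 := sub_ne_zero.mpr (hα k).symm
      refine ⟨fun z => u z + g c / (k - α) * (z - c) ^ k, by fun_prop, fun z hz => ?_⟩
      have hp : HasDerivAt (fun z : ℂ => (z - c) ^ k) (k * (z - c) ^ (k - 1)) z := by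
        simpa using ((hasDerivAt_id z).sub_const c).fun_pow k
      have hd := ((hu.differentiableAt (hG.mem_nhds hz)).hasDerivAt).fun_add
        (hp.const_mul (g c / (k - α)))
      rw [hd.deriv]
      have h1 := hue z hz
      have h2 := sub_smul_dslope g c z
      rw [smul_eq_mul] at h2
      have h3 : (z - c) * (k * (z - c) ^ (k - 1)) = k * (z - c) ^ k := by
        cases k with
        | zero => simp
        | succ k => simp [pow_succ]; ring
      have h4 : g c / (k - α) * (k - α) = g c := div_mul_cancel₀ _ hk0
      linear_combination h1 + g c / (k - α) * h3 + (z - c) ^ k * h2 + (z - c) ^ k * h4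
  obtain ⟨u, hu, hue⟩ := key (N + 1) 0 (by omega) g hg
  exact ⟨u, hu, fun z hz => by simpa using hue z hz⟩

/-! ### Holomorphic solutions at a singular point -/

section SingularPoint

variable {G : Set ℂ} {c : ℂ} {W W₁ V U : ℂ[X]}

/-- The exponent `α` and a primitive of the regular part of `2 V / W` at a simple zero of `W`. -/
theorem exists_primitive_regular_part (hG : IsOpen G) (hGs : IsSimplyConnected G) (hcG : c ∈ G)
    (hW₁ : ∀ z ∈ G, W₁.eval z ≠ 0) :
    ∃ B b : ℂ → ℂ, ∀ z ∈ G, HasDerivAt B (b z) z ∧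
      2 * V.eval z = W₁.eval z * (2 * V.eval c / W₁.eval c + (z - c) * b z) := by
  have hq : DifferentiableOn ℂ (fun z => 2 * V.eval z / W₁.eval z) G := by
    intro z hz
    exact ((V.differentiableAt.const_mul 2).fun_div W₁.differentiableAt
      (hW₁ z hz)).differentiableWithinAt
  -- The divided difference of `2 V / W₁` at `c` is holomorphic on all of `G`; it is the regular
  -- part `2 V / W - α / (z - c)`.
  obtain ⟨B, hB⟩ := exists_primitive hG hGs
    ((Complex.differentiableOn_dslope (hG.mem_nhds hcG)).mpr hq)
  refine ⟨B, _, fun z hz => ⟨hB z hz, ?_⟩⟩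
  have h := sub_smul_dslope (fun z => 2 * V.eval z / W₁.eval z) c z
  rw [smul_eq_mul] at h
  rw [h, add_sub_cancel, mul_div_cancel₀ _ (hW₁ z hz)]

/-- The substitution `g = exp B * u` removes the regular part of `2 V / W` and leaves `(z - c) u' =
α u + (U / W₁) exp (-B)`. -/
theorem exists_isHoloSolution (hG : IsOpen G) (hGs : IsSimplyConnected G) (hcG : c ∈ G)
    (hW : W = (X - C c) * W₁) (hW₁ : ∀ z ∈ G, W₁.eval z ≠ 0)
    (hα : ∀ n : ℕ, 2 * V.eval c / W₁.eval c ≠ n) : ∃ g, IsHoloSolution W V U G g := by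
  obtain ⟨B, b, hB⟩ := exists_primitive_regular_part (V := V) hG hGs hcG hW₁
  have hBd : DifferentiableOn ℂ B G := fun z hz =>
    (hB z hz).1.differentiableAt.differentiableWithinAt
  have hr : DifferentiableOn ℂ (fun z => U.eval z / W₁.eval z * Complex.exp (-B z)) G := by
    have h1 : DifferentiableOn ℂ (fun z => U.eval z / W₁.eval z) G := fun z hz =>
      (U.differentiableAt.fun_div W₁.differentiableAt (hW₁ z hz)).differentiableWithinAt
    fun_prop
  obtain ⟨u, hu, hue⟩ := exists_solution_singular hG hGs hcG hα hr
  refine ⟨fun z => Complex.exp (B z) * u z, by fun_prop, fun z hz => ?_⟩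
  have hd := ((hB z hz).1.cexp).fun_mul (hu.differentiableAt (hG.mem_nhds hz)).hasDerivAt
  rw [hd.deriv, hW, eval_mul]
  simp only [eval_sub, eval_X, eval_C]
  have h1 := hue z hz
  have h2 := (hB z hz).2
  have h3 : Complex.exp (B z) * Complex.exp (-B z) = 1 := by
    rw [← Complex.exp_add, add_neg_cancel, Complex.exp_zero]
  have h4 : U.eval z / W₁.eval z * W₁.eval z = U.eval z := div_mul_cancel₀ _ (hW₁ z hz)
  linear_combination W₁.eval z * Complex.exp (B z) * h1 - Complex.exp (B z) * u z * h2
    + U.eval z / W₁.eval z * W₁.eval z * h3 + h4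

/-- A solution that is not identically zero has a finite order `n` at `c`. Comparing leading
coefficients in the equation forces `α = n`, which is excluded. -/
theorem isHoloSolution_zero_eq (hG : IsOpen G) (hGc : IsPreconnected G) (hcG : c ∈ G)
    (hW : W = (X - C c) * W₁) (hW₁ : W₁.eval c ≠ 0)
    (hα : ∀ n : ℕ, 2 * V.eval c / W₁.eval c ≠ n) {h : ℂ → ℂ} (hh : IsHoloSolution W V 0 G h) :
    EqOn h 0 G := by
  have han := hh.1.analyticOnNhd hG
  refine han.eqOn_zero_of_preconnected_of_eventuallyEq_zero hGc hcG ?_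
  by_contra hne
  obtain ⟨n, q, hq, hq0, heq⟩ :=
    (AnalyticAt.exists_eventuallyEq_pow_smul_nonzero_iff (han c hcG)).mpr hne
  -- The factor `(z - c) ^ n` can be cancelled only off `c`; the relation at `c` is recovered below
  -- as a limit.
  have hev : ∀ᶠ z in 𝓝[≠] c, W₁.eval z * (n * q z + (z - c) * deriv q z)
      = 2 * V.eval z * q z := by
    filter_upwards [mem_nhdsWithin_of_mem_nhds (eventually_eventually_nhds.mpr heq),
      mem_nhdsWithin_of_mem_nhds hq.eventually_analyticAt,
      mem_nhdsWithin_of_mem_nhds (hG.mem_nhds hcG), self_mem_nhdsWithin] with z hz hqz hzG hzc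
    have hzc' : z - c ≠ 0 := sub_ne_zero.mpr hzc
    have hp : HasDerivAt (fun z : ℂ => (z - c) ^ n) (n * (z - c) ^ (n - 1)) z := by
      simpa using ((hasDerivAt_id z).sub_const c).fun_pow n
    have hd := (hp.fun_mul hqz.differentiableAt.hasDerivAt).congr_of_eventuallyEq
      (f₁ := h) (by
        filter_upwards [hz] with y hy
        simpa only [smul_eq_mul] using hy)
    have h1 := hh.2 z hzG
    rw [hd.deriv, hz.self_of_nhds, hW, eval_mul] at h1
    simp only [eval_sub, eval_X, eval_C, eval_zero, add_zero, smul_eq_mul] at h1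
    have h3 : (z - c) * (n * (z - c) ^ (n - 1)) = n * (z - c) ^ n := by
      cases n with
      | zero => simp
      | succ k => simp [pow_succ]; ring
    have h4 : (z - c) ^ n ≠ 0 := pow_ne_zero _ hzc'
    apply mul_left_cancel₀ h4
    linear_combination h1 - W₁.eval z * q z * h3
  have hL : ContinuousAt (fun z => W₁.eval z * (n * q z + (z - c) * deriv q z)) c := by
    have := hq.continuousAt
    have := hq.deriv.continuousAt
    have := W₁.continuous.continuousAt (x := c)
    fun_prop
  have hR : ContinuousAt (fun z => 2 * V.eval z * q z) c := by
    have := hq.continuousAt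
    have := V.continuous.continuousAt (x := c)
    fun_prop
  have hlim := tendsto_nhds_unique_of_eventuallyEq (hL.tendsto.mono_left nhdsWithin_le_nhds)
    (hR.tendsto.mono_left nhdsWithin_le_nhds) hev
  refine hα n ?_
  rw [div_eq_iff hW₁]
  apply mul_right_cancel₀ hq0
  simp only [sub_self, zero_mul, add_zero] at hlim
  linear_combination -hlim

theorem SemiClassical.IsHoloSolution.eqOn (hG : IsOpen G) (hGc : IsPreconnected G) (hcG : c ∈ G)
    (hW : W = (X - C c) * W₁) (hW₁ : W₁.eval c ≠ 0)
    (hα : ∀ n : ℕ, 2 * V.eval c / W₁.eval c ≠ n) {g h : ℂ → ℂ}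
    (hg : IsHoloSolution W V U G g) (hh : IsHoloSolution W V U G h) : EqOn g h G := by
  have h0 : IsHoloSolution W V 0 G (fun z => g z - h z) := by
    refine ⟨hg.1.fun_sub hh.1, fun z hz => ?_⟩
    rw [((hg.1.differentiableAt (hG.mem_nhds hz)).hasDerivAt.fun_sub
      (hh.1.differentiableAt (hG.mem_nhds hz)).hasDerivAt).deriv, eval_zero]
    linear_combination hg.2 z hz - hh.2 z hz
  exact fun z hz => sub_eq_zero.mp (isHoloSolution_zero_eq hG hGc hcG hW hW₁ hα h0 hz)

end SingularPoint

/-! ### The factorization of `W` -/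

section Factorization

variable {μ : ℕ → ℂ} {W V U : ℂ[X]} {m : ℕ} {x : Fin m → ℂ}

theorem SemiClassical.IsGeneric.eq_prod (h : IsGeneric μ W V U x) :
    W = C W.leadingCoeff * ∏ k, (X - C (x k)) := by
  have hW0 : W ≠ 0 := by
    rintro h0
    have := h.degree_W
    rw [h0, degree_zero] at this
    exact absurd this (by simp)
  have hdvd : ∏ k, (X - C (x k)) ∣ W := by
    refine Finset.prod_dvd_of_coprime (fun i _ j _ hij => ?_) fun k _ => dvd_iff_isRoot.mpr (h.isRoot k)
    exact pairwise_coprime_X_sub_C h.injective_x hij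
  obtain ⟨q, hq⟩ := hdvd
  have hmon : (∏ k, (X - C (x k))).Monic := monic_prod_of_monic _ _ fun k _ => monic_X_sub_C _
  have hdeg : (∏ k, (X - C (x k))).natDegree = m := by
    rw [natDegree_prod_of_monic _ _ fun k _ => monic_X_sub_C _]
    simp
  have hWdeg : W.natDegree = m := natDegree_eq_of_degree_eq_some h.degree_W
  have hq0 : q.natDegree = 0 := by
    have hqne : q ≠ 0 := by rintro rfl; exact hW0 (by simpa using hq)
    have := congrArg natDegree hq
    rw [hmon.natDegree_mul' hqne, hdeg, hWdeg] at this
    omega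
  rw [natDegree_eq_zero] at hq0
  obtain ⟨a, rfl⟩ := hq0
  have : W.leadingCoeff = a := by
    rw [hq, leadingCoeff_mul, hmon.leadingCoeff, leadingCoeff_C, one_mul]
  rw [this, hq, mul_comm]

theorem SemiClassical.IsGeneric.leadingCoeff_ne_zero (h : IsGeneric μ W V U x) :
    W.leadingCoeff ≠ 0 := by
  rw [Ne, leadingCoeff_eq_zero, ← degree_eq_bot, h.degree_W]
  simp

theorem SemiClassical.IsGeneric.eval_ne_zero (h : IsGeneric μ W V U x) {z : ℂ}
    (hz : ∀ k, x k ≠ z) : W.eval z ≠ 0 := by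
  rw [h.eq_prod, eval_mul, eval_C, eval_prod]
  refine mul_ne_zero h.leadingCoeff_ne_zero (Finset.prod_ne_zero_iff.mpr fun k _ => ?_)
  rw [eval_sub, eval_X, eval_C]
  exact sub_ne_zero.mpr (hz k).symm

/-- By the product rule `W' (x j) = W₁ (x j)`, so the exponent can be expressed with the cofactor of
the simple zero. -/
theorem SemiClassical.IsGeneric.exists_factor (h : IsGeneric μ W V U x) (j : Fin m) :
    ∃ W₁ : ℂ[X], W = (X - C (x j)) * W₁ ∧ (∀ z, (∀ k, k ≠ j → x k ≠ z) → W₁.eval z ≠ 0) ∧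
      expo W V (x j) = 2 * V.eval (x j) / W₁.eval (x j) := by
  classical
  have hW : W = (X - C (x j)) * (C W.leadingCoeff * ∏ k ∈ Finset.univ.erase j, (X - C (x k))) := by
    rw [mul_left_comm, Finset.mul_prod_erase Finset.univ (fun k => X - C (x k)) (Finset.mem_univ j)]
    exact h.eq_prod
  refine ⟨_, hW, fun z hz => ?_, ?_⟩
  · rw [eval_mul, eval_C, eval_prod]
    refine mul_ne_zero h.leadingCoeff_ne_zero (Finset.prod_ne_zero_iff.mpr fun k hk => ?_)
    rw [eval_sub, eval_X, eval_C]
    exact sub_ne_zero.mpr (hz k (Finset.ne_of_mem_erase hk)).symm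
  · unfold expo
    congr 1
    conv_lhs => rw [hW]
    simp [derivative_mul]

end Factorization

/-! ### Laurent series in `1 / z` -/

namespace SemiClassical

theorem toSeries_add (q r : ℂ[X]) : toSeries (q + r) = toSeries q + toSeries r := map_add _ q r

theorem toSeries_sub (q r : ℂ[X]) : toSeries (q - r) = toSeries q - toSeries r := map_sub _ q r

theorem toSeries_mul (q r : ℂ[X]) : toSeries (q * r) = toSeries q * toSeries r := map_mul _ q r

theorem toSeries_pow (q : ℂ[X]) (n : ℕ) : toSeries (q ^ n) = toSeries q ^ n := map_pow _ q n

theorem toSeries_two : toSeries 2 = 2 := map_ofNat _ 2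

theorem algebraMap_laurentSeries (a : ℂ) :
    algebraMap ℂ (HahnSeries ℤ ℂ) a = HahnSeries.C a := by
  rw [HahnSeries.algebraMap_apply', PowerSeries.algebraMap_apply, Algebra.algebraMap_self_apply,
    HahnSeries.ofPowerSeries_C]

theorem smul_eq_C_mul (a : ℂ) (g : LaurentSeries ℂ) : a • g = HahnSeries.C a * g := by
  ext n
  rw [HahnSeries.coeff_smul, HahnSeries.C_mul_eq_smul]
  rfl

theorem toSeries_C (a : ℂ) : toSeries (C a) = HahnSeries.C a := by
  unfold toSeries
  rw [aeval_C, algebraMap_laurentSeries]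

theorem toSeries_monomial (k : ℕ) (a : ℂ) :
    toSeries (monomial k a) = HahnSeries.single (-(k : ℤ)) a := by
  unfold toSeries
  rw [aeval_monomial, HahnSeries.single_pow, one_pow, algebraMap_laurentSeries]
  simp [HahnSeries.C_apply]

theorem coeff_toSeries_mul (q : ℂ[X]) (g : LaurentSeries ℂ) (n : ℤ) :
    (toSeries q * g).coeff n = q.sum fun k a => a * g.coeff (n + k) := by
  induction q using Polynomial.induction_on' with
  | add q r hq hr =>
    rw [toSeries_add, add_mul, HahnSeries.coeff_add, hq, hr,
      Polynomial.sum_add_index _ _ _ (by simp) (by intros; ring)]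
  | monomial k a =>
    rw [toSeries_monomial, Polynomial.sum_monomial_index _ _ (by simp)]
    have := HahnSeries.coeff_single_mul_add (r := a) (x := g) (a := n + k) (b := -(k : ℤ))
    rwa [add_neg_cancel_right] at this

theorem coeff_toSeries (q : ℂ[X]) (n : ℤ) :
    (toSeries q).coeff n = if n ≤ 0 then q.coeff (-n).toNat else 0 := by
  induction q using Polynomial.induction_on' with
  | add q r hq hr =>
    rw [toSeries_add, HahnSeries.coeff_add, hq, hr]
    split_ifs <;> simp
  | monomial k a =>
    rw [toSeries_monomial, HahnSeries.coeff_single, coeff_monomial]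
    split_ifs with h1 h2 h3 h4 h5 <;> first | rfl | omega

theorem coeff_dz (g : LaurentSeries ℂ) (n : ℤ) :
    (dz g).coeff n = -((n - 1 : ℤ) * g.coeff (n - 1)) := by
  unfold dz
  have := HahnSeries.coeff_single_mul_add (r := (1 : ℂ)) (x := LaurentSeries.derivative ℂ g)
    (a := n - 2) (b := 2)
  rw [sub_add_cancel] at this
  rw [HahnSeries.coeff_neg, this, one_mul, LaurentSeries.derivative_apply,
    LaurentSeries.hasseDeriv_coeff]
  simp only [Nat.cast_one, Ring.choose_one_right]
  rw [show n - 2 + 1 = n - 1 by ring, zsmul_eq_mul]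

theorem dz_sub (g h : LaurentSeries ℂ) : dz (g - h) = dz g - dz h := by
  ext n
  simp only [coeff_dz, HahnSeries.coeff_sub]
  ring

theorem dz_add (g h : LaurentSeries ℂ) : dz (g + h) = dz g + dz h := by
  ext n
  simp only [coeff_dz, HahnSeries.coeff_add]
  ring

theorem dz_toSeries (q : ℂ[X]) : dz (toSeries q) = toSeries (derivative q) := by
  ext n
  rw [coeff_dz, coeff_toSeries, coeff_toSeries, coeff_derivative]
  rcases lt_trichotomy n 1 with h | rfl | h
  · rw [if_pos (by omega), if_pos (by omega)]
    have h1 : (-(n - 1)).toNat = (-n).toNat + 1 := by omega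
    have h2 : (((-n).toNat : ℤ) : ℂ) = ((-n : ℤ) : ℂ) := by
      rw [Int.toNat_of_nonneg (by omega)]
    rw [Int.cast_natCast] at h2
    rw [h1, h2]
    push_cast
    ring
  · simp
  · rw [if_neg (by omega), if_neg (by omega)]
    simp

theorem dz_toSeries_mul (q : ℂ[X]) (g : LaurentSeries ℂ) :
    dz (toSeries q * g) = dz (toSeries q) * g + toSeries q * dz g := by
  induction q using Polynomial.induction_on' with
  | add q r hq hr => rw [toSeries_add, add_mul, dz_add, hq, hr, dz_add]; ring
  | monomial k a =>
    ext n
    rw [dz_toSeries, HahnSeries.coeff_add, coeff_dz, coeff_toSeries_mul, coeff_toSeries_mul,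
      coeff_toSeries_mul, derivative_monomial, Polynomial.sum_monomial_index _ _ (by simp),
      Polynomial.sum_monomial_index _ _ (by simp), Polynomial.sum_monomial_index _ _ (by simp),
      coeff_dz]
    cases k with
    | zero =>
      simp
      ring
    | succ k =>
      rw [Nat.add_sub_cancel, show n - 1 + ((k + 1 : ℕ) : ℤ) = n + k by push_cast; ring,
        show n + ((k + 1 : ℕ) : ℤ) - 1 = n + k by push_cast; ring]
      push_cast
      ring

/-! ### Order and degree bounds by integers -/

/-- `g` has order at least `d` in `1 / z`. -/
def OrderGE (g : LaurentSeries ℂ) (d : ℤ) : Prop := ∀ n < d, g.coeff n = 0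

/-- `q` has degree at most the integer `d`. -/
def DegreeLE (q : ℂ[X]) (d : ℤ) : Prop := ∀ k : ℕ, d < k → q.coeff k = 0

theorem OrderGE.mono {g : LaurentSeries ℂ} {d e : ℤ} (h : OrderGE g d) (he : e ≤ d) :
    OrderGE g e := fun n hn => h n (hn.trans_le he)

theorem OrderGE.add {g h : LaurentSeries ℂ} {d : ℤ} (hg : OrderGE g d) (hh : OrderGE h d) :
    OrderGE (g + h) d := fun n hn => by rw [HahnSeries.coeff_add, hg n hn, hh n hn, add_zero]

theorem OrderGE.sub {g h : LaurentSeries ℂ} {d : ℤ} (hg : OrderGE g d) (hh : OrderGE h d) :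
    OrderGE (g - h) d := fun n hn => by rw [HahnSeries.coeff_sub, hg n hn, hh n hn, sub_zero]

theorem OrderGE.smul {g : LaurentSeries ℂ} {d : ℤ} (hg : OrderGE g d) (a : ℂ) :
    OrderGE (a • g) d := fun n hn => by rw [HahnSeries.coeff_smul, hg n hn, smul_zero]

theorem OrderGE.dz {g : LaurentSeries ℂ} {d : ℤ} (hg : OrderGE g d) :
    OrderGE (dz g) (d + 1) := fun n hn => by
  rw [coeff_dz, hg (n - 1) (by omega), mul_zero, neg_zero]

theorem OrderGE.toSeries_mul {g : LaurentSeries ℂ} {d e : ℤ} (hg : OrderGE g d) {q : ℂ[X]}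
    (hq : DegreeLE q e) : OrderGE (toSeries q * g) (d - e) := fun n hn => by
  rw [coeff_toSeries_mul, Polynomial.sum_def]
  refine Finset.sum_eq_zero fun k hk => ?_
  by_cases hk' : e < k
  · exact absurd (hq k hk') (mem_support_iff.mp hk)
  · rw [hg _ (by omega), mul_zero]

theorem DegreeLE.of_natDegree_le {q : ℂ[X]} {d : ℕ} (h : q.natDegree ≤ d) : DegreeLE q d :=
  fun _ hk => coeff_eq_zero_of_natDegree_lt (by omega)

/-- Integer bounds keep the count exact for constants: the bound `-1` says that the derivative
vanishes. -/
theorem DegreeLE.derivative {q : ℂ[X]} {d : ℤ} (h : DegreeLE q d) :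
    DegreeLE (derivative q) (d - 1) := fun k hk => by
  rw [coeff_derivative, h (k + 1) (by push_cast; omega), zero_mul]

/-- This turns an order estimate for an expression in the `ε_n` into a degree bound for the
polynomial that it represents. -/
theorem OrderGE.natDegree_le {q : ℂ[X]} {d : ℕ} (h : OrderGE (toSeries q) (-d)) :
    q.natDegree ≤ d := by
  rw [natDegree_le_iff_coeff_eq_zero]
  intro k hk
  have := h (-(k : ℤ)) (by omega)
  simpa [coeff_toSeries] using this

/-! ### Moments and functions of the second kind -/

theorem momentForm_add (μ : ℕ → ℂ) (q r : ℂ[X]) :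
    momentForm μ (q + r) = momentForm μ q + momentForm μ r :=
  Polynomial.sum_add_index _ _ _ (by simp) (by intros; ring)

theorem momentForm_C_mul (μ : ℕ → ℂ) (a : ℂ) (q : ℂ[X]) :
    momentForm μ (C a * q) = a * momentForm μ q := by
  unfold momentForm
  rw [C_mul', Polynomial.sum_smul_index _ _ _ (by simp), Polynomial.sum_def, Polynomial.sum_def,
    Finset.mul_sum]
  exact Finset.sum_congr rfl fun k _ => by ring

theorem coeff_momentSeries (μ : ℕ → ℂ) (n : ℤ) :
    (momentSeries μ).coeff n = if 0 < n then μ (n - 1).toNat else 0 := by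
  unfold momentSeries
  have := HahnSeries.coeff_single_mul_add (r := (1 : ℂ))
    (x := ((PowerSeries.mk μ : PowerSeries ℂ) : LaurentSeries ℂ)) (a := n - 1) (b := 1)
  rw [sub_add_cancel] at this
  rw [this, one_mul, PowerSeries.coeff_coe]
  split_ifs with h1 h2 h3
  · omega
  · rfl
  · rw [PowerSeries.coeff_mk]
    congr 1
    omega
  · omega

theorem coeff_toSeries_mul_momentSeries (μ : ℕ → ℂ) (q : ℂ[X]) (k : ℕ) :
    (toSeries q * momentSeries μ).coeff (k + 1) = momentForm μ (X ^ k * q) := by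
  rw [coeff_toSeries_mul]
  induction q using Polynomial.induction_on' with
  | add q r hq hr =>
    rw [Polynomial.sum_add_index _ _ _ (by simp) (by intros; ring), hq, hr, mul_add, momentForm_add]
  | monomial i a =>
    rw [Polynomial.sum_monomial_index _ _ (by simp), X_pow_mul_monomial, momentForm,
      Polynomial.sum_monomial_index _ _ (by simp), coeff_momentSeries, if_pos (by omega)]
    congr 2
    omega

theorem coeff_polyPart (g : LaurentSeries ℂ) (k : ℕ) :
    (polyPart g).coeff k = g.coeff (-(k : ℤ)) := by
  unfold polyPart
  rw [finsetSum_coeff]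
  simp only [coeff_monomial]
  rw [Finset.sum_ite_eq']
  split_ifs with h
  · rfl
  · rw [Finset.mem_range, not_lt] at h
    exact (HahnSeries.coeff_eq_zero_of_lt_order (by omega)).symm

section Orthonormal

variable {μ : ℕ → ℂ} {p : ℕ → ℂ[X]}

theorem epsSeries_eq (n : ℕ) :
    epsSeries μ p n = toSeries (p n) * momentSeries μ - toSeries (assoc μ (p n)) := by
  rw [epsSeries, mul_comm]

theorem coeff_epsSeries_of_nonpos (n : ℕ) {i : ℤ} (hi : i ≤ 0) : (epsSeries μ p n).coeff i = 0 := by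
  rw [epsSeries, HahnSeries.coeff_sub, coeff_toSeries, if_pos hi, assoc, coeff_polyPart,
    show -((-i).toNat : ℤ) = i by omega, sub_self]

theorem coeff_epsSeries_succ (n k : ℕ) :
    (epsSeries μ p n).coeff (k + 1) = momentForm μ (X ^ k * p n) := by
  rw [epsSeries_eq, HahnSeries.coeff_sub, coeff_toSeries, if_neg (by omega), sub_zero,
    coeff_toSeries_mul_momentSeries]

theorem dz_epsSeries (n : ℕ) : dz (epsSeries μ p n) =
    toSeries (derivative (p n)) * momentSeries μ + toSeries (p n) * dz (momentSeries μ)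
      - toSeries (derivative (assoc μ (p n))) := by
  rw [epsSeries_eq, dz_sub, dz_toSeries_mul, dz_toSeries, dz_toSeries]

variable (hp : IsFormalOrthonormal μ p)

include hp

theorem IsFormalOrthonormal.natDegree_eq (n : ℕ) : (p n).natDegree = n :=
  natDegree_eq_of_degree_eq_some (hp.degree_eq n)

theorem IsFormalOrthonormal.leadingCoeff_ne_zero (n : ℕ) : (p n).leadingCoeff ≠ 0 := by
  rw [Ne, leadingCoeff_eq_zero, ← degree_eq_bot, hp.degree_eq]
  simp

/-- A multiple of `p d` removes the top coefficient of `q` and is itself orthogonal to `p n` because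
`d < n`. -/
theorem IsFormalOrthonormal.momentForm_eq_zero (n : ℕ) :
    ∀ (d : ℕ) (q : ℂ[X]), q.degree < d → d ≤ n → momentForm μ (q * p n) = 0 := by
  intro d
  induction d with
  | zero =>
    intro q hq _
    have : q = 0 := by
      rw [← degree_eq_bot]
      simpa [Nat.WithBot.lt_zero_iff] using hq
    rw [this, zero_mul, momentForm, Polynomial.sum_zero_index]
  | succ d ih =>
    intro q hq hd
    set a := q.coeff d / (p d).leadingCoeff with ha
    have hr : (q - C a * p d).degree < d := by
      rw [degree_lt_iff_coeff_zero]
      intro k hk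
      rw [coeff_sub, coeff_C_mul]
      rcases hk.eq_or_lt with rfl | hk
      · have : (p d).coeff d = (p d).leadingCoeff := by rw [leadingCoeff, hp.natDegree_eq]
        rw [this, ha, div_mul_cancel₀ _ (hp.leadingCoeff_ne_zero d), sub_self]
      · rw [coeff_eq_zero_of_degree_lt (hq.trans_le (by exact_mod_cast hk)),
          coeff_eq_zero_of_natDegree_lt (by rw [hp.natDegree_eq]; exact hk), mul_zero, sub_zero]
    have h1 := ih _ hr (by omega)
    have h2 : q * p n = (q - C a * p d) * p n + C a * (p d * p n) := by ring
    rw [h2, momentForm_add, momentForm_C_mul, h1, hp.orthonormal, if_neg (by omega), mul_zero,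
      add_zero]

/-- Subtracting the polynomial part leaves only negative powers of `z`; the coefficient of `z ^
(-k-1)` is the moment form of `X ^ k * p n`, which vanishes for `k < n`. -/
theorem IsFormalOrthonormal.orderGE_epsSeries (n : ℕ) : OrderGE (epsSeries μ p n) (n + 1) := by
  intro i hi
  rcases le_or_gt i 0 with h | h
  · exact coeff_epsSeries_of_nonpos n h
  · obtain ⟨k, rfl⟩ : ∃ k : ℕ, i = k + 1 := ⟨(i - 1).toNat, by omega⟩
    rw [coeff_epsSeries_succ]
    refine hp.momentForm_eq_zero n n _ ?_ le_rfl
    rw [degree_X_pow]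
    exact_mod_cast (by omega : k < n)

/-- Modulo lower degree, `p n` is its leading term, so this is the normalization of `p n * p n`. -/
theorem IsFormalOrthonormal.leading_epsSeries (n : ℕ) :
    (p n).leadingCoeff * (epsSeries μ p n).coeff (n + 1) = 1 := by
  rw [coeff_epsSeries_succ, ← momentForm_C_mul]
  have h1 := hp.orthonormal n n
  rw [if_pos rfl] at h1
  have h2 : (p n - C (p n).leadingCoeff * X ^ n).degree < (n : WithBot ℕ) := by
    refine (degree_sub_lt_left (p := p n) (q := C (p n).leadingCoeff * X ^ n) ?_ ?_ ?_).trans_eq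
      (hp.degree_eq n)
    · rw [degree_C_mul_X_pow _ (hp.leadingCoeff_ne_zero n), hp.degree_eq]
    · rw [Ne, ← leadingCoeff_eq_zero]
      exact hp.leadingCoeff_ne_zero n
    · rw [leadingCoeff_C_mul_X_pow]
  have h3 := hp.momentForm_eq_zero n n _ h2 le_rfl
  rw [← h1, show p n * p n = (p n - C (p n).leadingCoeff * X ^ n) * p n
    + C (p n).leadingCoeff * (X ^ n * p n) by ring, momentForm_add, h3, zero_add]

theorem IsFormalOrthonormal.degreeLE (n : ℕ) : DegreeLE (p n) n :=
  DegreeLE.of_natDegree_le (hp.natDegree_eq n).le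

/-- The Liouville–Ostrogradsky formula. -/
theorem IsFormalOrthonormal.casorati {n : ℕ} (hn : 1 ≤ n) :
    C (recA p n) * (p (n - 1) * assoc μ (p n) - p n * assoc μ (p (n - 1))) = 1 := by
  obtain ⟨n, rfl⟩ : ∃ k, n = k + 1 := ⟨n - 1, by omega⟩
  rw [Nat.add_sub_cancel]
  -- The series `f` cancels. The two products on the right have orders at least 0 and 2, so the
  -- polynomial on the left is a constant.
  have hD : toSeries (p n * assoc μ (p (n + 1)) - p (n + 1) * assoc μ (p n))
      = toSeries (p (n + 1)) * epsSeries μ p n - toSeries (p n) * epsSeries μ p (n + 1) := by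
    rw [epsSeries_eq, epsSeries_eq, toSeries_sub, toSeries_mul, toSeries_mul]
    ring
  have h1 := (hp.orderGE_epsSeries n).toSeries_mul (hp.degreeLE (n + 1))
  have h2 := (hp.orderGE_epsSeries (n + 1)).toSeries_mul (hp.degreeLE n)
  push_cast at h1 h2
  rw [sub_self] at h1
  rw [show (n : ℤ) + 1 + 1 - n = 2 by ring] at h2
  have h3 : natDegree (p n * assoc μ (p (n + 1)) - p (n + 1) * assoc μ (p n)) ≤ 0 := by
    refine OrderGE.natDegree_le ?_
    rw [hD]
    exact OrderGE.sub h1 (h2.mono (by norm_num))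
  have h4 := eq_C_of_natDegree_le_zero h3
  -- Only the top coefficient of `p (n + 1)` meets a nonzero coefficient of `ε_n` in degree 0.
  have h5 : (p n * assoc μ (p (n + 1)) - p (n + 1) * assoc μ (p n)).coeff 0
      = (p (n + 1)).leadingCoeff * (epsSeries μ p n).coeff (n + 1) := by
    have h6 := congrArg (fun g => HahnSeries.coeff g 0) hD
    simp only [HahnSeries.coeff_sub, h2 0 (by norm_num), sub_zero] at h6
    rw [coeff_toSeries, if_pos le_rfl] at h6
    simp only [neg_zero, Int.toNat_zero] at h6
    rw [h6, coeff_toSeries_mul, Polynomial.sum_def, Finset.sum_eq_single (n + 1)]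
    · rw [leadingCoeff, hp.natDegree_eq]
      congr 2
      push_cast
      ring
    · intro k hk hkn
      have := le_natDegree_of_mem_supp k hk
      rw [hp.natDegree_eq] at this
      rw [hp.orderGE_epsSeries n (0 + k) (by omega), mul_zero]
    · intro hk
      rw [notMem_support_iff.mp hk, zero_mul]
  rw [h4, h5, ← C_mul, recA, Nat.add_sub_cancel, ← C_1]
  congr 1
  rw [div_mul_eq_mul_div, div_eq_one_iff_eq (hp.leadingCoeff_ne_zero _), mul_left_comm,
    hp.leading_epsSeries, mul_one]

end Orthonormal

/-! ### The polynomials `Θ_n` and `Ω_n` -/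

section ThetaOmega

variable {μ : ℕ → ℂ} {p : ℕ → ℂ[X]} {W V U : ℂ[X]} {m : ℕ} {x : Fin m → ℂ}

/-- After `ε_n = f p_n - p_{n-1}^{(1)}` is inserted on the right, the terms in `f p_n p_n'` cancel,
and `f` survives only in `p_n ^ 2 (2 V f - W f')`, which is `-U p_n ^ 2`. -/
theorem IsGeneric.toSeries_Theta (h : IsGeneric μ W V U x) (n : ℕ) :
    toSeries (Theta μ W V U p n) =
      toSeries W * (epsSeries μ p n * dz (toSeries (p n))
          - dz (epsSeries μ p n) * toSeries (p n))
        + 2 * toSeries V * epsSeries μ p n * toSeries (p n) := by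
  rw [dz_epsSeries, dz_toSeries, epsSeries_eq, Theta]
  simp only [toSeries_sub, toSeries_mul, toSeries_pow, toSeries_two]
  linear_combination toSeries (p n) ^ 2 * h.ode

theorem IsGeneric.toSeries_Omega (h : IsGeneric μ W V U x) (n : ℕ) :
    toSeries (Omega μ W V U p n) =
        recA p n • (toSeries W * (epsSeries μ p (n - 1) * dz (toSeries (p n))
            - dz (epsSeries μ p n) * toSeries (p (n - 1))))
          + recA p n • (toSeries V * (epsSeries μ p (n - 1) * toSeries (p n)
            + epsSeries μ p n * toSeries (p (n - 1)))) := by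
  rw [dz_epsSeries, dz_toSeries, epsSeries_eq, epsSeries_eq, Omega]
  simp only [smul_eq_C_mul, toSeries_C, toSeries_sub, toSeries_mul, toSeries_add]
  linear_combination HahnSeries.C (recA p n) * toSeries (p n) * toSeries (p (n - 1)) * h.ode

theorem IsGeneric.degreeLE_W (h : IsGeneric μ W V U x) : DegreeLE W m :=
  DegreeLE.of_natDegree_le (natDegree_eq_of_degree_eq_some h.degree_W).le

theorem IsGeneric.degreeLE_V (h : IsGeneric μ W V U x) : DegreeLE V (m - 1) := fun k hk =>
  coeff_eq_zero_of_degree_lt (h.degree_V.trans_le (by exact_mod_cast (by omega : m ≤ k)))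

/-- Both `ε_n p_n'` and `ε_n' p_n` have order at least 2 and `ε_n p_n` has order at least 1;
multiplication by `W` and `V` lowers these by at most `m` and `m - 1`. -/
theorem IsGeneric.natDegree_Theta_le (h : IsGeneric μ W V U x) (hp : IsFormalOrthonormal μ p)
    (n : ℕ) : (Theta μ W V U p n).natDegree ≤ m - 2 := by
  refine OrderGE.natDegree_le ?_
  have hm := h.two_le
  rw [h.toSeries_Theta, dz_toSeries]
  have he := hp.orderGE_epsSeries n
  have hpn := hp.degreeLE n
  have h1 := (he.toSeries_mul hpn.derivative).toSeries_mul h.degreeLE_W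
  have h2 := (he.dz.toSeries_mul hpn).toSeries_mul h.degreeLE_W
  have h3 := (he.toSeries_mul hpn).toSeries_mul h.degreeLE_V
  have h4 := ((h1.mono (e := -((m - 2 : ℕ) : ℤ)) (by omega)).sub
    (h2.mono (by omega))).add ((h3.add h3).mono (by omega))
  convert h4 using 1
  ring

/-- Here `ε_{n-1}` has only order `n`, so the count is one worse than for `Θ_n`. -/
theorem IsGeneric.natDegree_Omega_le (h : IsGeneric μ W V U x) (hp : IsFormalOrthonormal μ p)
    {n : ℕ} (hn : 1 ≤ n) : (Omega μ W V U p n).natDegree ≤ m - 1 := by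
  refine OrderGE.natDegree_le ?_
  have hm := h.two_le
  rw [h.toSeries_Omega, dz_toSeries]
  have he := hp.orderGE_epsSeries n
  have he' := hp.orderGE_epsSeries (n - 1)
  have hpn := hp.degreeLE n
  have hpn' := hp.degreeLE (n - 1)
  have h1 := (he'.toSeries_mul hpn.derivative).toSeries_mul h.degreeLE_W
  have h2 := (he.dz.toSeries_mul hpn').toSeries_mul h.degreeLE_W
  have h3 := (he'.toSeries_mul hpn).toSeries_mul h.degreeLE_V
  have h4 := (he.toSeries_mul hpn').toSeries_mul h.degreeLE_V
  have h5 := ((h1.mono (e := -((m - 1 : ℕ) : ℤ)) (by omega)).sub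
    (h2.mono (by omega))).add ((h3.mono (by omega)).add (h4.mono (by omega)))
  convert h5.smul (recA p n) using 1
  simp only [smul_eq_C_mul]
  ring

end ThetaOmega

/-! ### Polynomial form of the differential system -/

section System

variable {μ : ℕ → ℂ} {p : ℕ → ℂ[X]} (W V U : ℂ[X]) (hp : IsFormalOrthonormal μ p)

include hp

/-- On the right, the terms containing derivatives of associated polynomials and those containing
`U` cancel; the rest is governed by the Casorati factor, which equals 1. -/
theorem IsFormalOrthonormal.system_fst {n : ℕ} (hn : 1 ≤ n) :
    W * derivative (p n) = (Omega μ W V U p n - V) * p n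
      - C (recA p n) * Theta μ W V U p n * p (n - 1) := by
  rw [Omega, Theta]
  linear_combination -(W * derivative (p n) + V * p n) * hp.casorati hn

/-- `Ω_n` involves derivatives of the index `n` only, so the derivative of the Casorati identity is
needed to pass to those of index `n - 1`. -/
theorem IsFormalOrthonormal.system_snd {n : ℕ} (hn : 1 ≤ n) :
    W * derivative (p (n - 1)) = C (recA p n) * Theta μ W V U p (n - 1) * p n
      - (Omega μ W V U p n + V) * p (n - 1) := by
  have h := hp.casorati hn
  have hd := congrArg derivative h
  simp only [derivative_mul, derivative_sub, derivative_C, derivative_one, zero_mul,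
    zero_add] at hd
  rw [Omega, Theta]
  linear_combination -(W * derivative (p (n - 1)) + V * p (n - 1)) * h + W * p (n - 1) * hd

end System

end SemiClassical

/-! ### Evaluation of power series -/

namespace SemiClassical

/-- The power series `φ` converges absolutely at `h`. -/
def AbsConvergesAt (φ : PowerSeries ℂ) (h : ℂ) : Prop :=
  Summable fun k => ‖PowerSeries.coeff k φ * h ^ k‖

/-- The value of a power series at `h`. -/
noncomputable def psEval (h : ℂ) (φ : PowerSeries ℂ) : ℂ := ∑' k, PowerSeries.coeff k φ * h ^ k

variable {h : ℂ}

theorem coeff_mul_mul_pow (φ ψ : PowerSeries ℂ) (h : ℂ) (k : ℕ) :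
    PowerSeries.coeff k (φ * ψ) * h ^ k = ∑ ij ∈ Finset.HasAntidiagonal.antidiagonal k,
      (PowerSeries.coeff ij.1 φ * h ^ ij.1) * (PowerSeries.coeff ij.2 ψ * h ^ ij.2) := by
  rw [PowerSeries.coeff_mul, Finset.sum_mul]
  refine Finset.sum_congr rfl fun ij hij => ?_
  rw [← Finset.HasAntidiagonal.mem_antidiagonal.mp hij, pow_add]
  ring

theorem AbsConvergesAt.mul {φ ψ : PowerSeries ℂ} (hφ : AbsConvergesAt φ h)
    (hψ : AbsConvergesAt ψ h) : AbsConvergesAt (φ * ψ) h := by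
  have := summable_norm_sum_mul_antidiagonal_of_summable_norm hφ hψ
  simpa only [AbsConvergesAt, coeff_mul_mul_pow] using this

theorem psEval_mul {φ ψ : PowerSeries ℂ} (hφ : AbsConvergesAt φ h)
    (hψ : AbsConvergesAt ψ h) : psEval h (φ * ψ) = psEval h φ * psEval h ψ := by
  have := tsum_mul_tsum_eq_tsum_sum_antidiagonal_of_summable_norm hφ hψ
  simpa only [psEval, coeff_mul_mul_pow] using this.symm

theorem AbsConvergesAt.add {φ ψ : PowerSeries ℂ} (hφ : AbsConvergesAt φ h)
    (hψ : AbsConvergesAt ψ h) : AbsConvergesAt (φ + ψ) h := by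
  refine Summable.of_norm_bounded (Summable.add hφ hψ) fun k => ?_
  rw [norm_norm, map_add, add_mul]
  exact norm_add_le _ _

theorem psEval_add {φ ψ : PowerSeries ℂ} (hφ : AbsConvergesAt φ h)
    (hψ : AbsConvergesAt ψ h) : psEval h (φ + ψ) = psEval h φ + psEval h ψ := by
  unfold psEval
  rw [← (Summable.of_norm hφ).tsum_add (Summable.of_norm hψ)]
  simp only [map_add, add_mul]

theorem absConvergesAt_coe (q : ℂ[X]) : AbsConvergesAt (q : PowerSeries ℂ) h := by
  refine summable_of_ne_finset_zero (s := q.support) fun k hk => ?_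
  rw [Polynomial.coeff_coe, notMem_support_iff.mp hk, zero_mul, norm_zero]

theorem psEval_coe (q : ℂ[X]) : psEval h (q : PowerSeries ℂ) = q.eval h := by
  unfold psEval
  rw [tsum_eq_sum (s := q.support), Polynomial.eval_eq_sum, Polynomial.sum_def]
  · simp only [Polynomial.coeff_coe]
  · intro k hk
    rw [Polynomial.coeff_coe, notMem_support_iff.mp hk, zero_mul]

theorem absConvergesAt_C (a : ℂ) : AbsConvergesAt (PowerSeries.C a) h := by
  rw [← Polynomial.coe_C]
  exact absConvergesAt_coe _

theorem absConvergesAt_geometric {a : ℂ} (ha : ‖a‖ * ‖h‖ < 1) :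
    AbsConvergesAt (PowerSeries.mk fun k => a ^ k) h := by
  unfold AbsConvergesAt
  simp only [PowerSeries.coeff_mk, ← mul_pow, norm_pow]
  exact summable_geometric_of_lt_one (norm_nonneg _) (by rwa [norm_mul])

theorem absConvergesAt_prod {ι : Type*} (s : Finset ι) (φ : ι → PowerSeries ℂ)
    (hφ : ∀ i ∈ s, AbsConvergesAt (φ i) h) : AbsConvergesAt (∏ i ∈ s, φ i) h := by
  classical
  induction s using Finset.induction_on with
  | empty =>
    rw [Finset.prod_empty, ← map_one (PowerSeries.C (R := ℂ))]
    exact absConvergesAt_C 1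
  | insert i s hi ih =>
    rw [Finset.prod_insert hi]
    exact (hφ i (Finset.mem_insert_self _ _)).mul
      (ih fun j hj => hφ j (Finset.mem_insert_of_mem hj))

theorem one_sub_mul_geometric (a : ℂ) :
    (1 - PowerSeries.C a * PowerSeries.X) * PowerSeries.mk (fun k => a ^ k) = 1 := by
  ext k
  rw [sub_mul, one_mul, mul_assoc, map_sub, PowerSeries.coeff_C_mul, PowerSeries.coeff_mk]
  cases k with
  | zero => simp
  | succ k =>
    rw [PowerSeries.coeff_succ_X_mul, PowerSeries.coeff_mk, PowerSeries.coeff_one,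
      if_neg (Nat.succ_ne_zero k), pow_succ]
    ring

/-! ### A majorant argument -/

/-- Boundedness of the terms of a formal solution of `(h g)' = B g + E`. -/
theorem exists_bound_of_formal_solution {μ : ℕ → ℂ} {B E : PowerSeries ℂ}
    (hB : AbsConvergesAt B h) (hE : AbsConvergesAt E h)
    (heq : PowerSeries.mk (fun k => (k + 1) * μ k) = B * PowerSeries.mk μ + E) :
    ∃ M, ∀ k, ‖μ k * h ^ k‖ ≤ M := by
  set S := ∑' k, ‖PowerSeries.coeff k B * h ^ k‖ with hS
  set T := ∑' k, ‖PowerSeries.coeff k E * h ^ k‖ with hT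
  have hS0 : 0 ≤ S := tsum_nonneg fun _ => norm_nonneg _
  have hT0 : 0 ≤ T := tsum_nonneg fun _ => norm_nonneg _
  -- From index `K` on, the factor `k + 1` exceeds `2 * S + T`; `M` covers the earlier terms and is
  -- at least 1.
  obtain ⟨K, hK⟩ := exists_nat_ge (2 * S + T)
  have hM1 : (0 : ℝ) ≤ ∑ j ∈ Finset.range K, ‖μ j * h ^ j‖ :=
    Finset.sum_nonneg fun _ _ => norm_nonneg _
  set M := 1 + ∑ j ∈ Finset.range K, ‖μ j * h ^ j‖ with hM
  refine ⟨M, fun k => ?_⟩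
  induction k using Nat.strong_induction_on with
  | _ k ih =>
  rcases lt_or_ge k K with hk | hk
  · have := Finset.single_le_sum (f := fun j => ‖μ j * h ^ j‖) (fun _ _ => norm_nonneg _)
      (Finset.mem_range.mpr hk)
    linarith
  set y := ‖μ k * h ^ k‖ with hy
  have hy0 : 0 ≤ y := norm_nonneg _
  have h1 : (k + 1) * (μ k * h ^ k) = ∑ ij ∈ Finset.HasAntidiagonal.antidiagonal k,
      (PowerSeries.coeff ij.1 B * h ^ ij.1) * (μ ij.2 * h ^ ij.2)
      + PowerSeries.coeff k E * h ^ k := by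
    have h2 := congrArg (fun φ => PowerSeries.coeff k φ * h ^ k) heq
    simp only [PowerSeries.coeff_mk, map_add, add_mul] at h2
    have h3 := coeff_mul_mul_pow B (PowerSeries.mk μ) h k
    simp only [PowerSeries.coeff_mk] at h3
    rw [← h3, ← h2]
    ring
  -- The convolution contains the term `y` that is being estimated, hence `M + y` in place of `M`.
  have h2 : ‖∑ ij ∈ Finset.HasAntidiagonal.antidiagonal k,
      (PowerSeries.coeff ij.1 B * h ^ ij.1) * (μ ij.2 * h ^ ij.2)‖ ≤ S * (M + y) := by
    refine (norm_sum_le _ _).trans ?_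
    have h3 : ∀ ij ∈ Finset.HasAntidiagonal.antidiagonal k,
        ‖(PowerSeries.coeff ij.1 B * h ^ ij.1) * (μ ij.2 * h ^ ij.2)‖
          ≤ ‖PowerSeries.coeff ij.1 B * h ^ ij.1‖ * (M + y) := by
      intro ij hij
      rw [norm_mul]
      refine mul_le_mul_of_nonneg_left ?_ (norm_nonneg _)
      have h4 := Finset.HasAntidiagonal.mem_antidiagonal.mp hij
      rcases (by omega : ij.2 < k ∨ ij.2 = k) with h5 | h5
      · exact (ih _ h5).trans (by linarith)
      · rw [h5]
        linarith
    refine (Finset.sum_le_sum h3).trans ?_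
    rw [← Finset.sum_mul]
    refine mul_le_mul_of_nonneg_right ?_ (by linarith)
    rw [Finset.Nat.sum_antidiagonal_eq_sum_range_succ_mk]
    exact Summable.sum_le_tsum _ (fun _ _ => norm_nonneg _) hB
  have h3 : ‖PowerSeries.coeff k E * h ^ k‖ ≤ T :=
    hE.le_tsum k fun _ _ => norm_nonneg _
  have h4 : ((k : ℝ) + 1) * y ≤ S * (M + y) + T := by
    have h5 : ((k : ℝ) + 1) * y = ‖((k : ℂ) + 1) * (μ k * h ^ k)‖ := by
      rw [norm_mul, ← hy]
      congr 1
      rw [← Nat.cast_add_one, ← Nat.cast_add_one, Complex.norm_natCast]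
    rw [h5, h1]
    exact (norm_add_le _ _).trans (add_le_add h2 h3)
  have hkK : (K : ℝ) ≤ k := by exact_mod_cast hk
  -- If `y > M ≥ 1`, then `S * (M + y) + T ≤ (2 * S + T) * y ≤ k * y`, which is less than `(k + 1) *
  -- y`.
  by_contra hcon
  have hMy : M < y := not_le.mp hcon
  nlinarith

/-! ### The moment series near infinity -/

theorem single_mul_toSeries {q : ℂ[X]} {d : ℕ} (hq : q.natDegree ≤ d) :
    HahnSeries.single (d : ℤ) (1 : ℂ) * toSeries q
      = HahnSeries.ofPowerSeries ℤ ℂ (reflect d q : ℂ[X]) := by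
  ext n
  have := HahnSeries.coeff_single_mul_add (r := (1 : ℂ)) (x := toSeries q) (a := n - d) (b := d)
  rw [sub_add_cancel, one_mul] at this
  rw [this, coeff_toSeries, PowerSeries.coeff_coe, Polynomial.coeff_coe, coeff_reflect]
  split_ifs with h1 h2 h3
  · exact coeff_eq_zero_of_natDegree_lt (by omega)
  · rw [revAt_le (by omega)]
    congr 1
    omega
  · rfl
  · rw [revAt_eq_self_of_lt (by omega)]
    exact (coeff_eq_zero_of_natDegree_lt (by omega)).symm

theorem eval_reflect_inv {q : ℂ[X]} {d : ℕ} (hq : q.natDegree ≤ d) {z : ℂ} (hz : z ≠ 0) :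
    (reflect d q).eval z⁻¹ = z⁻¹ ^ d * q.eval z := by
  let _ := invertibleOfNonzero hz
  have := eval₂_reflect_mul_pow (RingHom.id ℂ) z d q hq
  rw [invOf_eq_inv] at this
  change (reflect d q).eval z⁻¹ * z ^ d = q.eval z at this
  rw [← this, mul_comm, mul_assoc, inv_pow, mul_inv_cancel₀ (pow_ne_zero d hz), mul_one]

theorem momentSeries_eq (μ : ℕ → ℂ) : momentSeries μ =
    HahnSeries.single (1 : ℤ) (1 : ℂ) * HahnSeries.ofPowerSeries ℤ ℂ (PowerSeries.mk μ) := rfl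

theorem orderGE_momentSeries (μ : ℕ → ℂ) : OrderGE (momentSeries μ) 1 := fun n hn => by
  rw [coeff_momentSeries, if_neg (by omega)]

theorem dz_momentSeries (μ : ℕ → ℂ) : dz (momentSeries μ) =
    -(HahnSeries.single (2 : ℤ) (1 : ℂ)
      * HahnSeries.ofPowerSeries ℤ ℂ (PowerSeries.mk fun k => (k + 1) * μ k)) := by
  ext n
  have := HahnSeries.coeff_single_mul_add (r := (1 : ℂ))
    (x := HahnSeries.ofPowerSeries ℤ ℂ (PowerSeries.mk fun k : ℕ => (k + 1) * μ k))
    (a := n - 2) (b := 2)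
  rw [sub_add_cancel, one_mul] at this
  rw [HahnSeries.coeff_neg, this, coeff_dz, coeff_momentSeries, PowerSeries.coeff_coe,
    PowerSeries.coeff_mk]
  split_ifs with h1 h2 h3
  · omega
  · obtain ⟨k, rfl⟩ : ∃ k : ℕ, n = k + 2 := ⟨(n - 2).toNat, by omega⟩
    rw [show ((k : ℤ) + 2 - 1 - 1).toNat = k by omega, show ((k : ℤ) + 2 - 2).natAbs = k by omega]
    push_cast
    ring
  · simp
  · omega

section Generic

variable {μ : ℕ → ℂ} {W V U : ℂ[X]} {m : ℕ} {x : Fin m → ℂ} (hgen : IsGeneric μ W V U x)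

include hgen

theorem IsGeneric.natDegree_W : W.natDegree = m := natDegree_eq_of_degree_eq_some hgen.degree_W

theorem IsGeneric.natDegree_V_le : V.natDegree ≤ m - 1 := by
  have := hgen.two_le
  rw [natDegree_le_iff_coeff_eq_zero]
  exact fun k hk => hgen.degreeLE_V k (by omega)

/-- The equation forces this bound: `f` has order 1 and `f'` order 2, so `W f'` and `V f` both have
order at least `2 - m`. -/
theorem IsGeneric.natDegree_U_le : U.natDegree ≤ m - 2 := by
  have hm := hgen.two_le
  refine OrderGE.natDegree_le ?_
  have h1 := (orderGE_momentSeries μ).dz.toSeries_mul hgen.degreeLE_W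
  have h2 := (orderGE_momentSeries μ).toSeries_mul hgen.degreeLE_V
  have h3 := (h1.mono (e := -((m - 2 : ℕ) : ℤ)) (by omega)).sub ((h2.add h2).mono (by omega))
  convert h3 using 1
  linear_combination -hgen.ode

/-- Multiplication of the equation by `h ^ (m - 2)` clears all negative powers: `f'` supplies a
factor `h ^ 2` for `W` and `f` a factor `h` for `V`. -/
theorem IsGeneric.powerSeries_ode :
    -((reflect m W : ℂ[X]) : PowerSeries ℂ) * PowerSeries.mk (fun k => (k + 1) * μ k)
      = 2 * ((reflect (m - 1) V : ℂ[X]) : PowerSeries ℂ) * PowerSeries.mk μ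
        + ((reflect (m - 2) U : ℂ[X]) : PowerSeries ℂ) := by
  have hm := hgen.two_le
  apply HahnSeries.ofPowerSeries_injective (Γ := ℤ)
  have hode := hgen.ode
  rw [dz_momentSeries, momentSeries_eq] at hode
  have hs1 : HahnSeries.single (m : ℤ) (1 : ℂ)
      = HahnSeries.single ((m - 2 : ℕ) : ℤ) (1 : ℂ) * HahnSeries.single (2 : ℤ) (1 : ℂ) := by
    rw [HahnSeries.single_mul_single, one_mul]
    congr 2
    omega
  have hs2 : HahnSeries.single ((m - 1 : ℕ) : ℤ) (1 : ℂ)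
      = HahnSeries.single ((m - 2 : ℕ) : ℤ) (1 : ℂ) * HahnSeries.single (1 : ℤ) (1 : ℂ) := by
    rw [HahnSeries.single_mul_single, one_mul]
    congr 2
    omega
  rw [map_mul, map_neg, map_add, map_mul, map_mul, map_ofNat,
    ← single_mul_toSeries hgen.natDegree_W.le, ← single_mul_toSeries hgen.natDegree_V_le,
    ← single_mul_toSeries hgen.natDegree_U_le, hs1, hs2]
  linear_combination HahnSeries.single ((m - 2 : ℕ) : ℤ) (1 : ℂ) * hode

theorem IsGeneric.reflect_W_eq : ((reflect m W : ℂ[X]) : PowerSeries ℂ)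
    = PowerSeries.C W.leadingCoeff * ∏ k, (1 - PowerSeries.C (x k) * PowerSeries.X) := by
  apply HahnSeries.ofPowerSeries_injective (Γ := ℤ)
  rw [← single_mul_toSeries hgen.natDegree_W.le]
  conv_lhs => rw [hgen.eq_prod]
  have h1 : toSeries (∏ k, (X - C (x k)))
      = ∏ k, (HahnSeries.single (-1 : ℤ) (1 : ℂ) - HahnSeries.C (x k)) := by
    unfold toSeries
    rw [map_prod]
    refine Finset.prod_congr rfl fun k _ => ?_
    rw [map_sub, aeval_X]
    congr 1
    exact toSeries_C (x k)
  have h2 : HahnSeries.single (m : ℤ) (1 : ℂ)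
      = ∏ _k : Fin m, HahnSeries.single (1 : ℤ) (1 : ℂ) := by
    rw [Finset.prod_const, Finset.card_univ, Fintype.card_fin, HahnSeries.single_pow]
    simp
  rw [toSeries_mul, toSeries_C, h1, mul_left_comm, h2, ← Finset.prod_mul_distrib, map_mul,
    HahnSeries.ofPowerSeries_C, map_prod]
  congr 1
  refine Finset.prod_congr rfl fun k _ => ?_
  rw [map_sub, map_one (HahnSeries.ofPowerSeries ℤ ℂ), map_mul, HahnSeries.ofPowerSeries_C, HahnSeries.ofPowerSeries_X, mul_sub,
    HahnSeries.single_mul_single, add_neg_cancel, one_mul, mul_comm]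
  rfl

/-- The reversed polynomial is a constant times `∏ (1 - x_k h)`, whose inverse is a product of
geometric series. -/
theorem IsGeneric.exists_inverse_reflect_W : ∃ Φ : PowerSeries ℂ,
    ((reflect m W : ℂ[X]) : PowerSeries ℂ) * Φ = 1 ∧
      ∀ h : ℂ, (∀ k, ‖x k‖ * ‖h‖ < 1) → AbsConvergesAt Φ h := by
  refine ⟨PowerSeries.C W.leadingCoeff⁻¹ * ∏ k, PowerSeries.mk (fun i => x k ^ i), ?_, ?_⟩
  · rw [hgen.reflect_W_eq, mul_mul_mul_comm, ← map_mul,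
      mul_inv_cancel₀ hgen.leadingCoeff_ne_zero, map_one, one_mul, ← Finset.prod_mul_distrib]
    exact Finset.prod_eq_one fun k _ => one_sub_mul_geometric (x k)
  · intro h hh
    exact (absConvergesAt_C _).mul
      (absConvergesAt_prod _ _ fun k _ => absConvergesAt_geometric (hh k))

theorem IsGeneric.exists_bound_moments {h : ℂ} (hh : ∀ k, ‖x k‖ * ‖h‖ < 1) :
    ∃ M, ∀ k, ‖μ k * h ^ k‖ ≤ M := by
  obtain ⟨Φ, hΦ, hΦc⟩ := hgen.exists_inverse_reflect_W
  have hc := hΦc h hh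
  have hV := absConvergesAt_coe (h := h) (reflect (m - 1) V)
  have hU := absConvergesAt_coe (h := h) (reflect (m - 2) U)
  refine exists_bound_of_formal_solution
    (B := PowerSeries.C (-2) * ((reflect (m - 1) V : ℂ[X]) : PowerSeries ℂ) * Φ)
    (E := PowerSeries.C (-1) * ((reflect (m - 2) U : ℂ[X]) : PowerSeries ℂ) * Φ)
    (((absConvergesAt_C _).mul hV).mul hc) (((absConvergesAt_C _).mul hU).mul hc) ?_
  rw [map_neg, map_neg, map_one, map_ofNat]
  linear_combination -Φ * hgen.powerSeries_ode
    - PowerSeries.mk (fun k => (k + 1) * μ k) * hΦ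

theorem IsGeneric.exists_radius_between {z : ℂ} (hz : ∀ k, ‖x k‖ < ‖z‖) :
    ∃ r, 0 < r ∧ r < ‖z‖ ∧ ∀ k, ‖x k‖ < r := by
  have h0 : 0 < ‖z‖ := (norm_nonneg _).trans_lt (hz ⟨0, by have := hgen.two_le; omega⟩)
  have h1 : ∀ᶠ r in 𝓝[<] ‖z‖, ∀ k, ‖x k‖ < r := by
    rw [Filter.eventually_all]
    exact fun k => mem_nhdsWithin_of_mem_nhds (lt_mem_nhds (hz k))
  have h2 : ∀ᶠ r in 𝓝[<] ‖z‖, 0 < r := mem_nhdsWithin_of_mem_nhds (lt_mem_nhds h0)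
  obtain ⟨r, ⟨hr1, hr2⟩, hr3⟩ := ((h1.and h2).and self_mem_nhdsWithin).exists
  exact ⟨r, hr2, hr3, hr1⟩

theorem IsGeneric.ne_zero_of_large {z : ℂ} (hz : ∀ k, ‖x k‖ < ‖z‖) : z ≠ 0 :=
  norm_pos_iff.mp ((norm_nonneg _).trans_lt (hz ⟨0, by have := hgen.two_le; omega⟩))

/-- The moment series and its derivative, majorized on a disk in the variable `1 / z`. -/
theorem IsGeneric.exists_majorant {z : ℂ} (hz : ∀ k, ‖x k‖ < ‖z‖) :
    ∃ ρ, ‖z⁻¹‖ < ρ ∧ ∃ u : ℕ → ℝ, Summable u ∧ ∀ k, ∀ h : ℂ, ‖h‖ ≤ ρ → ‖μ k * h ^ k‖ ≤ u k := by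
  -- With `max |x_k| < r < s < |z|`, boundedness at `1 / r` gives geometric decay of ratio `r / s`
  -- on the disk of radius `1 / s`.
  obtain ⟨r, hr0, hrz, hr⟩ := hgen.exists_radius_between hz
  obtain ⟨s, hs1, hs2⟩ := exists_between hrz
  have hs0 : 0 < s := hr0.trans hs1
  obtain ⟨M, hM⟩ := hgen.exists_bound_moments (h := ((r⁻¹ : ℝ) : ℂ)) fun k => by
    rw [Complex.norm_real, Real.norm_of_nonneg (by positivity), ← div_eq_mul_inv, div_lt_one hr0]
    exact hr k
  refine ⟨s⁻¹, ?_, fun k => M * (r / s) ^ k, ?_, fun k h hh => ?_⟩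
  · rw [norm_inv]
    exact inv_strictAnti₀ hs0 hs2
  · exact (summable_geometric_of_lt_one (by positivity) ((div_lt_one hs0).mpr hs1)).mul_left M
  · have h1 := hM k
    rw [norm_mul, norm_pow, Complex.norm_real, Real.norm_of_nonneg (by positivity)] at h1
    rw [norm_mul, norm_pow]
    calc ‖μ k‖ * ‖h‖ ^ k ≤ ‖μ k‖ * s⁻¹ ^ k := by gcongr
      _ = ‖μ k‖ * r⁻¹ ^ k * (r / s) ^ k := by
        rw [mul_assoc, ← mul_pow]
        congr 2
        field_simp
      _ ≤ M * (r / s) ^ k := mul_le_mul_of_nonneg_right h1 (by positivity)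

theorem IsGeneric.absConvergesAt_moments {z : ℂ} (hz : ∀ k, ‖x k‖ < ‖z‖) :
    AbsConvergesAt (PowerSeries.mk μ) z⁻¹ := by
  obtain ⟨ρ, hρ, u, hu, hb⟩ := hgen.exists_majorant hz
  refine Summable.of_nonneg_of_le (fun _ => norm_nonneg _) (fun k => ?_) hu
  rw [PowerSeries.coeff_mk]
  exact hb k _ hρ.le

theorem IsGeneric.summable {z : ℂ} (hz : ∀ k, ‖x k‖ < ‖z‖) :
    Summable (fun k : ℕ => μ k * z⁻¹ ^ (k + 1)) := by
  have h1 := (Summable.of_norm (hgen.absConvergesAt_moments hz)).mul_right z⁻¹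
  refine h1.congr fun k => ?_
  rw [PowerSeries.coeff_mk, pow_succ, mul_assoc]

theorem IsGeneric.hasDerivAt_sum_inv {z : ℂ} (hz : ∀ k, ‖x k‖ < ‖z‖) :
    HasDerivAt (fun h => ∑' k, μ k * h ^ (k + 1))
      (psEval z⁻¹ (PowerSeries.mk fun k => (k + 1) * μ k)) z⁻¹ ∧
    AbsConvergesAt (PowerSeries.mk fun k => (k + 1) * μ k) z⁻¹ := by
  obtain ⟨ρ, hρ, u, hu, hb⟩ := hgen.exists_majorant hz
  have hρ0 : 0 ≤ ρ := (norm_nonneg _).trans hρ.le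
  have hd : ∀ k : ℕ, ∀ h : ℂ,
      HasDerivAt (fun h => μ k * h ^ (k + 1)) ((k + 1) * μ k * h ^ k) h := by
    intro k h
    refine ((hasDerivAt_pow (k + 1) h).const_mul (μ k)).congr_deriv ?_
    rw [Nat.add_sub_cancel]
    push_cast
    ring
  have hdiff : ∀ k, DifferentiableOn ℂ (fun h => μ k * h ^ (k + 1)) (Metric.ball 0 ρ) :=
    fun k h _ => (hd k h).differentiableAt.differentiableWithinAt
  have hbound : ∀ k, ∀ h ∈ Metric.ball (0 : ℂ) ρ, ‖μ k * h ^ (k + 1)‖ ≤ u k * ρ := by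
    intro k h hh
    have h1 : ‖h‖ ≤ ρ := (mem_ball_zero_iff.mp hh).le
    rw [pow_succ, ← mul_assoc, norm_mul]
    exact mul_le_mul (hb k h h1) h1 (norm_nonneg _) ((norm_nonneg _).trans (hb k h h1))
  have hmem : z⁻¹ ∈ Metric.ball (0 : ℂ) ρ := mem_ball_zero_iff.mpr hρ
  have hsum := Complex.hasSum_deriv_of_summable_norm (hu.mul_right ρ) hdiff Metric.isOpen_ball
    hbound hmem
  have hda := (Complex.differentiableOn_tsum_of_summable_norm (hu.mul_right ρ) hdiff
    Metric.isOpen_ball hbound).differentiableAt (Metric.isOpen_ball.mem_nhds hmem)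
  simp only [(hd _ _).deriv] at hsum
  refine ⟨hda.hasDerivAt.congr_deriv ?_, ?_⟩
  · rw [← hsum.tsum_eq]
    simp only [psEval, PowerSeries.coeff_mk]
  · simpa only [AbsConvergesAt, PowerSeries.coeff_mk] using hsum.summable.norm

/-- The sum of the moment series satisfies the differential equation near infinity. -/
theorem IsGeneric.hasDerivAt_sum {z : ℂ} (hz : ∀ k, ‖x k‖ < ‖z‖) :
    HasDerivAt (fun z => ∑' k, μ k * z⁻¹ ^ (k + 1))
      ((2 * V.eval z * (∑' k, μ k * z⁻¹ ^ (k + 1)) + U.eval z) / W.eval z) z := by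
  have hm := hgen.two_le
  have hz0 := hgen.ne_zero_of_large hz
  have hW0 : W.eval z ≠ 0 := hgen.eval_ne_zero fun k hk => (hz k).ne (by rw [hk])
  obtain ⟨h1, h2⟩ := hgen.hasDerivAt_sum_inv hz
  have h3 := h1.comp z (hasDerivAt_inv hz0)
  refine h3.congr_deriv ?_
  rw [eq_div_iff hW0]
  have hg := hgen.absConvergesAt_moments hz
  have hW := absConvergesAt_coe (h := z⁻¹) (-reflect m W)
  have hV := absConvergesAt_coe (h := z⁻¹) (C 2 * reflect (m - 1) V)
  have hU := absConvergesAt_coe (h := z⁻¹) (reflect (m - 2) U)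
  have hode := hgen.powerSeries_ode
  rw [show -((reflect m W : ℂ[X]) : PowerSeries ℂ) = ((-reflect m W : ℂ[X]) : PowerSeries ℂ) from
      (Polynomial.coe_neg _).symm, show 2 * ((reflect (m - 1) V : ℂ[X]) : PowerSeries ℂ)
      = ((C 2 * reflect (m - 1) V : ℂ[X]) : PowerSeries ℂ) by
        rw [Polynomial.coe_mul, Polynomial.coe_C, map_ofNat]] at hode
  -- Evaluation at `1 / z` respects sums and products of absolutely convergent series, so the formal
  -- identity becomes one of numbers.
  have hev := congrArg (psEval z⁻¹) hode
  rw [psEval_mul hW h2, psEval_add (hV.mul hg) hU, psEval_mul hV hg, psEval_coe, psEval_coe,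
    psEval_coe, eval_neg, eval_mul, eval_C, eval_reflect_inv hgen.natDegree_W.le hz0,
    eval_reflect_inv hgen.natDegree_V_le hz0, eval_reflect_inv hgen.natDegree_U_le hz0] at hev
  have hF : ∑' k, μ k * z⁻¹ ^ (k + 1) = z⁻¹ * psEval z⁻¹ (PowerSeries.mk μ) := by
    unfold psEval
    rw [← tsum_mul_left]
    refine tsum_congr fun k => ?_
    rw [PowerSeries.coeff_mk, pow_succ]
    ring
  have hp1 : z⁻¹ ^ m = z⁻¹ ^ (m - 2) * z⁻¹ ^ 2 := by rw [← pow_add]; congr 1; omega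
  have hp2 : z⁻¹ ^ (m - 1) = z⁻¹ ^ (m - 2) * z⁻¹ := by rw [← pow_succ]; congr 1; omega
  rw [hp1, hp2] at hev
  have hne : z⁻¹ ^ (m - 2) ≠ 0 := pow_ne_zero _ (inv_ne_zero hz0)
  rw [hF, ← inv_pow]
  apply mul_left_cancel₀ hne
  linear_combination hev

end Generic

end SemiClassical

/-! ### Branches of `f` and `w` -/

namespace SemiClassical

section Branches

variable {μ : ℕ → ℂ} {W V U : ℂ[X]} {m : ℕ} {x : Fin m → ℂ} {D : Set ℂ} {z₁ : ℂ} {f g w : ℂ → ℂ}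

/-- The difference of two solutions satisfies the homogeneous equation, as does `w`. -/
theorem hasDerivAt_sub_div_eq_zero {z : ℂ}
    (hf : HasDerivAt f ((2 * V.eval z * f z + U.eval z) / W.eval z) z)
    (hg : HasDerivAt g ((2 * V.eval z * g z + U.eval z) / W.eval z) z)
    (hw : HasDerivAt w (2 * V.eval z * w z / W.eval z) z) (hw0 : w z ≠ 0) :
    HasDerivAt (fun z => (f z - g z) / w z) 0 z := by
  refine ((hf.fun_sub hg).fun_div hw hw0).congr_deriv ?_
  rw [div_eq_zero_iff]
  left
  ring

theorem IsHoloSolution.hasDerivAt {G : Set ℂ} (hg : IsHoloSolution W V U G g) (hG : IsOpen G)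
    {z : ℂ} (hz : z ∈ G) (hW : W.eval z ≠ 0) :
    HasDerivAt g ((2 * V.eval z * g z + U.eval z) / W.eval z) z := by
  refine (hg.1.differentiableAt (hG.mem_nhds hz)).hasDerivAt.congr_deriv ?_
  rw [eq_div_iff hW, mul_comm]
  exact hg.2 z hz

theorem IsGeneric.isOpen_large (_ : IsGeneric μ W V U x) :
    IsOpen {z : ℂ | ∀ k, ‖x k‖ < ‖z‖} := by
  rw [ofPred_forall]
  exact isOpen_iInter_of_finite fun k => isOpen_lt continuous_const continuous_norm

theorem IsGeneric.eval_ne_zero_of_avoids (hgen : IsGeneric μ W V U x) (hD : ∀ k, x k ∉ D) {z : ℂ}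
    (hz : z ∈ D) : W.eval z ≠ 0 :=
  hgen.eval_ne_zero fun k hk => hD k (hk ▸ hz)

theorem IsGeneric.exists_isBranch (hgen : IsGeneric μ W V U x) (hD : IsOpen D)
    (hDs : IsSimplyConnected D) (hDx : ∀ k, x k ∉ D) (hz₁ : z₁ ∈ D)
    (hlarge : ∀ k, ‖x k‖ < ‖z₁‖) : ∃ f w : ℂ → ℂ, IsBranch μ W V x D z₁ f w := by
  have hW : ∀ z ∈ D, W.eval z ≠ 0 := fun z hz => hgen.eval_ne_zero_of_avoids hDx hz
  obtain ⟨Q, hQ⟩ := exists_primitive hD hDs (f := fun z => 2 * V.eval z / W.eval z)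
    fun z hz => ((V.differentiableAt.const_mul 2).fun_div W.differentiableAt
      (hW z hz)).differentiableWithinAt
  set w : ℂ → ℂ := fun z => Complex.exp (Q z) with hwdef
  have hw0 : ∀ z, w z ≠ 0 := fun z => Complex.exp_ne_zero _
  have hw : ∀ z ∈ D, HasDerivAt w (2 * V.eval z * w z / W.eval z) z := fun z hz =>
    ((hQ z hz).cexp).congr_deriv (by rw [mul_comm, div_mul_eq_mul_div])
  obtain ⟨R, hR⟩ := exists_primitive hD hDs (f := fun z => U.eval z / W.eval z / w z)
    fun z hz => ((U.differentiableAt.fun_div W.differentiableAt (hW z hz)).fun_div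
      (hw z hz).differentiableAt (hw0 z)).differentiableWithinAt
  set F : ℂ → ℂ := fun z => ∑' k, μ k * z⁻¹ ^ (k + 1) with hF
  -- Variation of constants, with the constant chosen so that `f z₁ = F z₁`; near `z₁` the quotient
  -- `(f - F) / w` is then constantly zero.
  set f : ℂ → ℂ := fun z => w z * (R z - R z₁ + F z₁ / w z₁) with hfdef
  have hf : ∀ z ∈ D, HasDerivAt f ((2 * V.eval z * f z + U.eval z) / W.eval z) z := by
    intro z hz
    refine ((hw z hz).fun_mul (((hR z hz).sub_const _).add_const _)).congr_deriv ?_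
    rw [mul_div_cancel₀ _ (hw0 z), hfdef]
    ring
  refine ⟨f, w, hD, hDs.isPathConnected.isConnected, hDx, hz₁, hlarge,
    fun z hz => (hf z hz).differentiableAt.differentiableWithinAt, ?_,
    fun z hz => (hw z hz).differentiableAt.differentiableWithinAt, fun z hz => ?_,
    fun z _ => hw0 z⟩
  · obtain ⟨r, hr, hrs⟩ := Metric.isOpen_iff.mp (hD.inter hgen.isOpen_large) z₁ ⟨hz₁, hlarge⟩
    have hder : ∀ z ∈ Metric.ball z₁ r, HasDerivAt (fun z => (f z - F z) / w z) 0 z := fun z hz =>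
      hasDerivAt_sub_div_eq_zero (hf z (hrs hz).1) (hgen.hasDerivAt_sum (hrs hz).2)
        (hw z (hrs hz).1) (hw0 z)
    filter_upwards [Metric.ball_mem_nhds z₁ hr] with z hz
    have hconst := Metric.isOpen_ball.is_const_of_deriv_eq_zero
      (convex_ball z₁ r).isPreconnected
      (fun y hy => (hder y hy).differentiableAt.differentiableWithinAt)
      (fun y hy => (hder y hy).deriv) hz (Metric.mem_ball_self hr)
    have h1 : f z₁ - F z₁ = 0 := by
      simp only [hfdef, sub_self, zero_add]
      rw [mul_div_cancel₀ _ (hw0 z₁), sub_self]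
    simp only [h1, zero_div, div_eq_zero_iff, hw0, or_false, sub_eq_zero] at hconst
    rw [hconst]
    exact (hgen.summable (hrs hz).2).hasSum
  · rw [(hw z hz).deriv, mul_div_cancel₀ _ (hW z hz)]

theorem IsBranch.hasDerivAt_w (hb : IsBranch μ W V x D z₁ f w) (hgen : IsGeneric μ W V U x) {z : ℂ}
    (hz : z ∈ D) : HasDerivAt w (2 * V.eval z * w z / W.eval z) z := by
  refine (hb.holo_w.differentiableAt (hb.isOpen.mem_nhds hz)).hasDerivAt.congr_deriv ?_
  rw [eq_div_iff (hgen.eval_ne_zero_of_avoids hb.avoids hz), mul_comm]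
  exact hb.ode_w z hz

/-- Near `z₁` the function is the sum of the series, which satisfies the equation; the identity
theorem extends this to `D`. -/
theorem IsBranch.hasDerivAt_f (hb : IsBranch μ W V x D z₁ f w) (hgen : IsGeneric μ W V U x) {z : ℂ}
    (hz : z ∈ D) : HasDerivAt f ((2 * V.eval z * f z + U.eval z) / W.eval z) z := by
  have hf := hb.holo_f.analyticOnNhd hb.isOpen
  have han : AnalyticOnNhd ℂ
      (fun z => W.eval z * deriv f z - (2 * V.eval z * f z + U.eval z)) D := by
    have h1 := (hb.holo_f.deriv hb.isOpen)
    have h2 := hb.holo_f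
    exact DifferentiableOn.analyticOnNhd (by fun_prop) hb.isOpen
  have hev : (fun z => W.eval z * deriv f z - (2 * V.eval z * f z + U.eval z)) =ᶠ[𝓝 z₁] 0 := by
    filter_upwards [eventually_eventually_nhds.mpr hb.germ_f,
      hgen.isOpen_large.mem_nhds hb.large, hb.isOpen.mem_nhds hb.mem] with y hy hyl hyD
    have h1 : f =ᶠ[𝓝 y] fun z => ∑' k, μ k * z⁻¹ ^ (k + 1) := by
      filter_upwards [hy] with t ht
      exact ht.tsum_eq.symm
    have h2 := (hgen.hasDerivAt_sum hyl).congr_of_eventuallyEq h1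
    rw [show ∑' k, μ k * y⁻¹ ^ (k + 1) = f y from h1.self_of_nhds.symm] at h2
    rw [h2.deriv, mul_div_cancel₀ _ (hgen.eval_ne_zero_of_avoids hb.avoids hyD), sub_self]
    rfl
  have h := han.eqOn_zero_of_preconnected_of_eventuallyEq_zero hb.isConnected.isPreconnected
    hb.mem hev hz
  refine (hb.holo_f.differentiableAt (hb.isOpen.mem_nhds hz)).hasDerivAt.congr_deriv ?_
  rw [eq_div_iff (hgen.eval_ne_zero_of_avoids hb.avoids hz), mul_comm]
  exact sub_eq_zero.mp h

theorem IsBranch.exists_connection (hb : IsBranch μ W V x D z₁ f w) (hgen : IsGeneric μ W V U x)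
    {G : Set ℂ} (hG : IsOpen G) (c : ℂ) (hg : IsHoloSolution W V U G g) {S : Set ℂ}
    (hS : IsConnected S) (hSO : S ⊆ D ∩ (G \ {c})) : ∃ K : ℂ, ∀ z ∈ S, f z = g z + K * w z := by
  set O := D ∩ (G \ {c}) with hO
  have hOo : IsOpen O := hb.isOpen.inter (hG.sdiff isClosed_singleton)
  obtain ⟨s₀, hs₀⟩ := hS.nonempty
  have hder : ∀ z ∈ O, HasDerivAt (fun z => (f z - g z) / w z) 0 z := fun z hz =>
    hasDerivAt_sub_div_eq_zero (hb.hasDerivAt_f hgen hz.1)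
      (hg.hasDerivAt hG hz.2.1 (hgen.eval_ne_zero_of_avoids hb.avoids hz.1))
      (hb.hasDerivAt_w hgen hz.1) (hb.ne_zero_w z hz.1)
  -- `S` need not be open, so the constancy is proved on the component of the open set `O` that
  -- contains it.
  have hsub := connectedComponentIn_subset O s₀
  obtain ⟨K, hK⟩ := (hOo.connectedComponentIn (x := s₀)).exists_is_const_of_deriv_eq_zero
    isPreconnected_connectedComponentIn
    (fun y hy => (hder y (hsub hy)).differentiableAt.differentiableWithinAt)
    (fun y hy => (hder y (hsub hy)).deriv)
  refine ⟨K, fun z hz => ?_⟩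
  have h1 := hK z (hS.isPreconnected.subset_connectedComponentIn hs₀ hSO hz)
  rw [div_eq_iff (hb.ne_zero_w z (hSO hz).1)] at h1
  rw [← h1, add_sub_cancel]

end Branches

/-! ### The differential system for `Y` -/

section System

variable {μ : ℕ → ℂ} {p : ℕ → ℂ[X]} (hp : IsFormalOrthonormal μ p)

include hp

/-- Compared with the system for the `p_n`, the sign of `V` changes and a term `U p_n` appears. In
`ε_n = f p_n - p_{n-1}^{(1)}` this `U` cancels against that of `W f'`, and division by `w` restores
the sign of `V`. -/
theorem IsFormalOrthonormal.assoc_fst (W V U : ℂ[X]) {n : ℕ} (hn : 1 ≤ n) :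
    W * derivative (assoc μ (p n)) = (Omega μ W V U p n + V) * assoc μ (p n)
      - C (recA p n) * Theta μ W V U p n * assoc μ (p (n - 1)) + U * p n := by
  rw [Omega, Theta]
  linear_combination
    -(W * derivative (assoc μ (p n)) - V * assoc μ (p n) - U * p n) * hp.casorati hn

theorem IsFormalOrthonormal.assoc_snd (W V U : ℂ[X]) {n : ℕ} (hn : 1 ≤ n) :
    W * derivative (assoc μ (p (n - 1))) = C (recA p n) * Theta μ W V U p (n - 1) * assoc μ (p n)
      - (Omega μ W V U p n - V) * assoc μ (p (n - 1)) + U * p (n - 1) := by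
  have h := hp.casorati hn
  have hd := congrArg derivative h
  simp only [derivative_mul, derivative_sub, derivative_C, derivative_one, zero_mul,
    zero_add] at hd
  rw [Omega, Theta]
  linear_combination
    -(W * derivative (assoc μ (p (n - 1))) - V * assoc μ (p (n - 1)) - U * p (n - 1)) * h
      + W * assoc μ (p (n - 1)) * hd

/-- Subtracting `f / w` times the first column reduces the determinant to the Casorati identity. -/
theorem IsFormalOrthonormal.det_matY (f w : ℂ → ℂ) {n : ℕ} (hn : 1 ≤ n) (z : ℂ) :
    recA p n * (matY μ p f w n z).det = (w z)⁻¹ := by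
  have h := congrArg (eval z) (hp.casorati hn)
  simp only [eval_mul, eval_sub, eval_C, eval_one] at h
  rw [matY, Matrix.det_fin_two_of, epsFun, epsFun, div_eq_mul_inv, div_eq_mul_inv]
  linear_combination (w z)⁻¹ * h

theorem IsFormalOrthonormal.det_matY_ne_zero (f w : ℂ → ℂ) {n : ℕ} (hn : 1 ≤ n) {z : ℂ}
    (hw : w z ≠ 0) : (matY μ p f w n z).det ≠ 0 := fun h0 => by
  have := hp.det_matY f w hn z
  rw [h0, mul_zero] at this
  exact inv_ne_zero hw this.symm

/-- The differential system, in terms of the values of `f` and `w` that are carried along a path. -/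
theorem IsFormalOrthonormal.hasDerivWithinAt_matY {𝕜 : Type*} [NontriviallyNormedField 𝕜]
    [NormedAlgebra 𝕜 ℂ] {W V U : ℂ[X]} {n : ℕ} (hn : 1 ≤ n) {γ φ ω : 𝕜 → ℂ} {γ' : ℂ} {s : Set 𝕜}
    {t : 𝕜} (hW : W.eval (γ t) ≠ 0) (hω0 : ω t ≠ 0) (hγ : HasDerivWithinAt γ γ' s t)
    (hφ : HasDerivWithinAt φ
      (γ' * ((2 * V.eval (γ t) * φ t + U.eval (γ t)) / W.eval (γ t))) s t)
    (hω : HasDerivWithinAt ω (γ' * (2 * V.eval (γ t) * ω t / W.eval (γ t))) s t) (i k : Fin 2) :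
    HasDerivWithinAt (fun r => matY μ p (fun _ => φ r) (fun _ => ω r) n (γ r) i k)
      (γ' * (coeffA μ W V U p n (γ t)
        * matY μ p (fun _ => φ t) (fun _ => ω t) n (γ t)) i k) s t := by
  have hpoly : ∀ q : ℂ[X], HasDerivWithinAt (fun r => q.eval (γ r))
      ((derivative q).eval (γ t) * γ') s t := fun q =>
    (q.hasDerivAt (γ t)).comp_hasDerivWithinAt t hγ
  have hsecond : ∀ l : ℕ, HasDerivWithinAt
      (fun r => (φ r * (p l).eval (γ r) - (assoc μ (p l)).eval (γ r)) / ω r) _ s t := fun l =>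
    ((hφ.fun_mul (hpoly (p l))).fun_sub (hpoly (assoc μ (p l)))).fun_div hω hω0
  have e1 := congrArg (eval (γ t)) (hp.system_fst W V U hn)
  have e2 := congrArg (eval (γ t)) (hp.system_snd W V U hn)
  have e3 := congrArg (eval (γ t)) (hp.assoc_fst W V U hn)
  have e4 := congrArg (eval (γ t)) (hp.assoc_snd W V U hn)
  simp only [eval_mul, eval_sub, eval_add, eval_C] at e1 e2 e3 e4
  -- The quotient rule for an entry `(φ P - Q) / ω` of the second column, where `P` is an orthogonal
  -- polynomial and `Q` its associated polynomial; `r₁` and `r₂` are the matching parts of their two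
  -- systems.
  have hcol : ∀ P Q P' Q' r₁ r₂ : ℂ,
      W.eval (γ t) * P' = r₁ - V.eval (γ t) * P →
      W.eval (γ t) * Q' = r₂ + V.eval (γ t) * Q + U.eval (γ t) * P →
      ((γ' * ((2 * V.eval (γ t) * φ t + U.eval (γ t)) / W.eval (γ t)) * P + φ t * (P' * γ')
        - Q' * γ') * ω t - (φ t * P - Q) * (γ' * (2 * V.eval (γ t) * ω t / W.eval (γ t))))
          / ω t ^ 2
      = γ' * ((W.eval (γ t))⁻¹ * ((φ t * r₁ - r₂ - V.eval (γ t) * (φ t * P - Q)) / ω t)) := by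
    intro P Q P' Q' r₁ r₂ h1 h2
    field_simp
    linear_combination γ' * (φ t * h1 - h2)
  fin_cases i <;> fin_cases k
  · refine (hpoly (p n)).congr_deriv ?_
    simp only [coeffA, matY, epsFun, Matrix.smul_apply, Matrix.mul_apply,
      Fin.sum_univ_two, smul_eq_mul, Fin.zero_eta, Matrix.of_apply, Matrix.cons_val',
      Matrix.cons_val_zero, Matrix.cons_val_one, Matrix.cons_val_fin_one]
    field_simp
    linear_combination γ' * e1
  · refine (hsecond n).congr_deriv ?_
    simp only [coeffA, matY, epsFun, Matrix.smul_apply, Matrix.mul_apply,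
      Fin.sum_univ_two, smul_eq_mul, Fin.zero_eta, Fin.mk_one, Matrix.of_apply, Matrix.cons_val',
      Matrix.cons_val_zero, Matrix.cons_val_one, Matrix.cons_val_fin_one]
    rw [hcol _ _ _ _ ((Omega μ W V U p n).eval (γ t) * (p n).eval (γ t)
        - recA p n * (Theta μ W V U p n).eval (γ t) * (p (n - 1)).eval (γ t))
      ((Omega μ W V U p n).eval (γ t) * (assoc μ (p n)).eval (γ t)
        - recA p n * (Theta μ W V U p n).eval (γ t) * (assoc μ (p (n - 1))).eval (γ t))
      (by linear_combination e1) (by linear_combination e3)]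
    ring
  · refine (hpoly (p (n - 1))).congr_deriv ?_
    simp only [coeffA, matY, epsFun, Matrix.smul_apply, Matrix.mul_apply,
      Fin.sum_univ_two, smul_eq_mul, Fin.zero_eta, Fin.mk_one, Matrix.of_apply, Matrix.cons_val',
      Matrix.cons_val_zero, Matrix.cons_val_one, Matrix.cons_val_fin_one]
    field_simp
    linear_combination γ' * e2
  · refine (hsecond (n - 1)).congr_deriv ?_
    simp only [coeffA, matY, epsFun, Matrix.smul_apply, Matrix.mul_apply,
      Fin.sum_univ_two, smul_eq_mul, Fin.mk_one, Matrix.of_apply, Matrix.cons_val',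
      Matrix.cons_val_zero, Matrix.cons_val_one, Matrix.cons_val_fin_one]
    rw [hcol _ _ _ _ (recA p n * (Theta μ W V U p (n - 1)).eval (γ t) * (p n).eval (γ t)
        - (Omega μ W V U p n).eval (γ t) * (p (n - 1)).eval (γ t))
      (recA p n * (Theta μ W V U p (n - 1)).eval (γ t) * (assoc μ (p n)).eval (γ t)
        - (Omega μ W V U p n).eval (γ t) * (assoc μ (p (n - 1))).eval (γ t))
      (by linear_combination e2) (by linear_combination e4)]
    ring

end System

/-! ### Monodromy -/

section Monodromy

/-- Up to sign, the functions differentiated here are the entries of `X⁻¹ (Z - X)`, by Cramer's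
rule. They are constant along the path and vanish at its start, so no regularity of `A` enters. -/
theorem IsSolutionAlong.eqOn {A : ℂ → Matrix (Fin 2) (Fin 2) ℂ} {γ : ℝ → ℂ}
    {X Z : ℝ → Matrix (Fin 2) (Fin 2) ℂ} (hX : IsSolutionAlong A γ X) (hZ : IsSolutionAlong A γ Z)
    (hdet : ∀ t ∈ Icc (0 : ℝ) 1, (X t).det ≠ 0) (h0 : Z 0 = X 0) {t : ℝ} (ht : t ∈ Icc (0 : ℝ) 1) :
    Z t = X t := by
  have hder : ∀ k l : Fin 2, ∀ t ∈ Icc (0 : ℝ) 1, HasDerivWithinAt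
      (fun s => (X s 0 l * (Z s 1 k - X s 1 k) - X s 1 l * (Z s 0 k - X s 0 k))
        / (X s 0 0 * X s 1 1 - X s 0 1 * X s 1 0)) 0 (Icc 0 1) t := by
    intro k l t ht
    have hd := hdet t ht
    rw [Matrix.det_fin_two] at hd
    refine ((((hX t ht 0 l).fun_mul ((hZ t ht 1 k).fun_sub (hX t ht 1 k))).fun_sub
      ((hX t ht 1 l).fun_mul ((hZ t ht 0 k).fun_sub (hX t ht 0 k)))).fun_div
      (((hX t ht 0 0).fun_mul (hX t ht 1 1)).fun_sub ((hX t ht 0 1).fun_mul (hX t ht 1 0)))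
      hd).congr_deriv ?_
    rw [div_eq_zero_iff]
    left
    simp only [Matrix.mul_apply, Fin.sum_univ_two]
    ring
  have hzero : ∀ k l : Fin 2,
      X t 0 l * (Z t 1 k - X t 1 k) - X t 1 l * (Z t 0 k - X t 0 k) = 0 := by
    intro k l
    have h1 := constant_of_derivWithin_zero
      (fun s hs => (hder k l s hs).differentiableWithinAt)
      (fun s hs => (hder k l s ⟨hs.1, hs.2.le⟩).derivWithin
        (uniqueDiffOn_Icc zero_lt_one s ⟨hs.1, hs.2.le⟩)) t ht
    have hd := hdet t ht
    rw [Matrix.det_fin_two] at hd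
    simpa [h0, hd] using h1
  have hd := hdet t ht
  rw [Matrix.det_fin_two] at hd
  ext i k
  apply sub_eq_zero.mp
  apply mul_left_cancel₀ hd
  rw [mul_zero]
  fin_cases i
  · change _ * (Z t 0 k - X t 0 k) = 0
    linear_combination X t 0 1 * hzero k 0 - X t 0 0 * hzero k 1
  · change _ * (Z t 1 k - X t 1 k) = 0
    linear_combination X t 1 1 * hzero k 0 - X t 1 0 * hzero k 1

section Contour

variable {G : Set ℂ} {c z₀ : ℂ} {γ : ℝ → ℂ} (hγ : IsContourAbout G c z₀ γ)

include hγ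

theorem IsContourAbout.hasDerivWithinAt {t : ℝ} (ht : t ∈ Icc (0 : ℝ) 1) :
    HasDerivWithinAt γ (derivWithin γ (Icc 0 1) t) (Icc 0 1) t :=
  ((hγ.smooth.differentiableOn one_ne_zero) t ht).hasDerivWithinAt

/-- The partial winding integral serves as a branch of `log (γ - c)` along the path, normalized to 0
at the start. -/
theorem IsContourAbout.hasDerivWithinAt_winding {t : ℝ} (ht : t ∈ Icc (0 : ℝ) 1) :
    HasDerivWithinAt (fun u => ∫ s in (0 : ℝ)..u, derivWithin γ (Icc 0 1) s / (γ s - c))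
      (derivWithin γ (Icc 0 1) t / (γ t - c)) (Icc 0 1) t := by
  have hcont : ContinuousOn (fun s => derivWithin γ (Icc 0 1) s / (γ s - c)) (Icc 0 1) := by
    refine (hγ.smooth.continuousOn_derivWithin (uniqueDiffOn_Icc zero_lt_one) le_rfl).div
      (hγ.smooth.continuousOn.sub continuousOn_const) fun s hs => ?_
    exact sub_ne_zero.mpr (hγ.mapsTo s hs).2
  have : Fact (t ∈ Icc (0 : ℝ) 1) := ⟨ht⟩
  refine intervalIntegral.integral_hasDerivWithinAt_right (t := Icc 0 1) ?_
    (hcont.stronglyMeasurableAtFilter_nhdsWithin measurableSet_Icc t) (hcont t ht)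
  refine (hcont.mono ?_).intervalIntegrable
  rw [uIcc_of_le ht.1]
  exact Icc_subset_Icc_right ht.2

end Contour

/-- The continuation along the path is explicit: `ω` continues `w` through `α L` and the primitive
`B`, and `φ = g + K ω` continues `f`. At the end `g` and `B` return to their values while `L` is
`2πi`, so only the factor `exp (2πiα)` of `ω` remains. -/
theorem IsFormalOrthonormal.isMonodromyAt {μ : ℕ → ℂ} {p : ℕ → ℂ[X]}
    (hp : IsFormalOrthonormal μ p) {W W₁ V U : ℂ[X]} {G : Set ℂ} (hG : IsOpen G)
    (hGs : IsSimplyConnected G) {c : ℂ} (hcG : c ∈ G) (hW : W = (X - C c) * W₁)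
    (hW₁ : ∀ z ∈ G, W₁.eval z ≠ 0) {f g w : ℂ → ℂ} (hg : IsHoloSolution W V U G g) {z₀ K : ℂ}
    (hf : f z₀ = g z₀ + K * w z₀) (hw : w z₀ ≠ 0) {n : ℕ} (hn : 1 ≤ n) :
    IsMonodromyAt (coeffA μ W V U p n) (matY μ p f w n) G c z₀
      (monodromyMatrix K (2 * V.eval c / W₁.eval c)) := by
  intro γ hγ
  set α := 2 * V.eval c / W₁.eval c with hα
  obtain ⟨B, b, hB⟩ := exists_primitive_regular_part (V := V) hG hGs hcG hW₁
  set L : ℝ → ℂ := fun u => ∫ s in (0 : ℝ)..u, derivWithin γ (Icc 0 1) s / (γ s - c) with hL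
  set ω : ℝ → ℂ := fun t => w z₀ * Complex.exp (α * L t + (B (γ t) - B z₀)) with hωdef
  set φ : ℝ → ℂ := fun t => g (γ t) + K * ω t with hφdef
  set Z : ℝ → Matrix (Fin 2) (Fin 2) ℂ :=
    fun t => matY μ p (fun _ => φ t) (fun _ => ω t) n (γ t) with hZdef
  have hω0 : ∀ t, ω t ≠ 0 := fun t => mul_ne_zero hw (Complex.exp_ne_zero _)
  have hne : ∀ t ∈ Icc (0 : ℝ) 1, γ t - c ≠ 0 := fun t ht => sub_ne_zero.mpr (hγ.mapsTo t ht).2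
  have hWeval : ∀ z, W.eval z = (z - c) * W₁.eval z := fun z => by
    rw [hW, eval_mul, eval_sub, eval_X, eval_C]
  have hW0 : ∀ t ∈ Icc (0 : ℝ) 1, W.eval (γ t) ≠ 0 := fun t ht => by
    rw [hWeval]
    exact mul_ne_zero (hne t ht) (hW₁ _ (hγ.mapsTo t ht).1)
  have hω : ∀ t ∈ Icc (0 : ℝ) 1, HasDerivWithinAt ω
      (derivWithin γ (Icc 0 1) t * (2 * V.eval (γ t) * ω t / W.eval (γ t))) (Icc 0 1) t := by
    intro t ht
    have h1 : HasDerivWithinAt (fun t => B (γ t)) (b (γ t) * derivWithin γ (Icc 0 1) t)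
        (Icc 0 1) t :=
      (hB _ (hγ.mapsTo t ht).1).1.comp_hasDerivWithinAt t (hγ.hasDerivWithinAt ht)
    have h2 := (((hγ.hasDerivWithinAt_winding ht).const_mul α).fun_add
      (h1.sub_const (B z₀))).cexp.const_mul (w z₀)
    refine h2.congr_deriv ?_
    have h3 := hne t ht
    have h4 := hW₁ _ (hγ.mapsTo t ht).1
    rw [(hB _ (hγ.mapsTo t ht).1).2, hWeval, hωdef]
    simp only [hL]
    field_simp
    ring
  have hφ : ∀ t ∈ Icc (0 : ℝ) 1, HasDerivWithinAt φ (derivWithin γ (Icc 0 1) t *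
      ((2 * V.eval (γ t) * φ t + U.eval (γ t)) / W.eval (γ t))) (Icc 0 1) t := by
    intro t ht
    have h1 : HasDerivWithinAt (fun t => g (γ t)) _ (Icc 0 1) t :=
      (hg.hasDerivAt hG (hγ.mapsTo t ht).1 (hW0 t ht)).comp_hasDerivWithinAt t
        (hγ.hasDerivWithinAt ht)
    refine (h1.fun_add ((hω t ht).const_mul K)).congr_deriv ?_
    rw [hφdef]
    ring
  have hZ : IsSolutionAlong (coeffA μ W V U p n) γ Z := fun t ht i k =>
    hp.hasDerivWithinAt_matY hn (hW0 t ht) (hω0 t) (hγ.hasDerivWithinAt ht) (hφ t ht) (hω t ht) i k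
  have hω_start : ω 0 = w z₀ := by
    simp only [hωdef, hL, intervalIntegral.integral_same, hγ.start, sub_self, mul_zero, add_zero,
      Complex.exp_zero, mul_one]
  have hZ0 : Z 0 = matY μ p f w n z₀ := by
    simp only [hZdef, hφdef, matY, epsFun, hω_start, hγ.start, hf]
  refine ⟨⟨Z, hZ, hZ0⟩, fun Z' hZ' hZ'0 => ?_⟩
  rw [hZ.eqOn hZ' (fun t _ => hp.det_matY_ne_zero _ _ hn (hω0 t)) (hZ'0.trans hZ0.symm)
    (right_mem_Icc.mpr zero_le_one)]
  set e := Complex.exp (-2 * Real.pi * Complex.I * α) with he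
  have he0 : e ≠ 0 := Complex.exp_ne_zero _
  have hω_end : ω 1 = w z₀ * e⁻¹ := by
    simp only [hωdef, hL, hγ.winding, hγ.finish, sub_self, add_zero, he]
    rw [← Complex.exp_neg]
    congr 2
    ring
  -- With `ω` multiplied by `e⁻¹`, each new entry of the second column is `K (1 - e)` times the
  -- first-column entry plus `e` times the old one; these are the coefficients in the monodromy
  -- matrix.
  have hentry : ∀ P Q : ℂ, ((g z₀ + K * (w z₀ * e⁻¹)) * P - Q) / (w z₀ * e⁻¹)
      = P * (K * (1 - e)) + ((g z₀ + K * w z₀) * P - Q) / w z₀ * e := by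
    intro P Q
    field_simp
    ring
  ext i k
  fin_cases i <;> fin_cases k <;>
  simp only [hZdef, hφdef, matY, epsFun, monodromyMatrix, hω_end, hγ.finish, hf, Matrix.mul_apply,
      Fin.sum_univ_two, Fin.zero_eta, Fin.mk_one, Matrix.of_apply, Matrix.cons_val',
      Matrix.cons_val_zero, Matrix.cons_val_one, Matrix.cons_val_fin_one, mul_zero, mul_one,
      add_zero, hentry, ← he]

end Monodromy

end SemiClassical

/-! ### The main theorem -/

theorem theorem1 (μ : ℕ → ℂ) (W V U : ℂ[X]) {m : ℕ} (x : Fin m → ℂ) (p : ℕ → ℂ[X])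
    (hp : IsFormalOrthonormal μ p) (hgen : IsGeneric μ W V U x) :
    -- the polynomials `Θ_n` and `Ω_n`: bounded degrees, and their expressions with `ε_n`
    (∀ n : ℕ, (Theta μ W V U p n).natDegree ≤ m - 2 ∧
      toSeries (Theta μ W V U p n) =
        toSeries W * (epsSeries μ p n * dz (toSeries (p n))
            - dz (epsSeries μ p n) * toSeries (p n))
          + 2 * toSeries V * epsSeries μ p n * toSeries (p n)) ∧
    (∀ n : ℕ, 1 ≤ n → (Omega μ W V U p n).natDegree ≤ m - 1 ∧
      toSeries (Omega μ W V U p n) =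
        recA p n • (toSeries W * (epsSeries μ p (n - 1) * dz (toSeries (p n))
            - dz (epsSeries μ p n) * toSeries (p (n - 1))))
          + recA p n • (toSeries V * (epsSeries μ p (n - 1) * toSeries (p n)
            + epsSeries μ p n * toSeries (p (n - 1))))) ∧
    -- the series converges outside of the smallest disk about `0` holding the singular points
    (∀ z : ℂ, (∀ k, ‖x k‖ < ‖z‖) → Summable (fun k : ℕ => μ k * z⁻¹ ^ (k + 1))) ∧
    -- branches of `f` and `w` exist outside of cuts
    (∀ (D : Set ℂ) (z₁ : ℂ), IsOpen D → IsSimplyConnected D → (∀ k, x k ∉ D) → z₁ ∈ D →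
      (∀ k, ‖x k‖ < ‖z₁‖) → ∃ f w : ℂ → ℂ, IsBranch μ W V x D z₁ f w) ∧
    -- for every choice of the branches
    (∀ (D : Set ℂ) (z₁ : ℂ) (f w : ℂ → ℂ), IsBranch μ W V x D z₁ f w →
      -- the differential system, of which `Y` is a fundamental matrix
      (∀ n : ℕ, 1 ≤ n → ∀ z ∈ D,
        (∀ i k, HasDerivAt (fun u => matY μ p f w n u i k)
          ((coeffA μ W V U p n z * matY μ p f w n z) i k) z) ∧
        (matY μ p f w n z).det ≠ 0) ∧
      -- the monodromy at `x j`, in a region `G` that holds no other singular point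
      (∀ (j : Fin m) (G : Set ℂ), IsOpen G → IsSimplyConnected G → x j ∈ G →
        (∀ k, k ≠ j → x k ∉ G) →
        -- `fj` is the unique holomorphic solution about `x j`
        ∃ fj : ℂ → ℂ, IsHoloSolution W V U G fj ∧
          (∀ g, IsHoloSolution W V U G g → EqOn g fj G) ∧
          ∀ S : Set ℂ, IsConnected S → S ⊆ D ∩ (G \ {x j}) →
            ∃ Cj : ℂ, (∀ z ∈ S, f z = fj z + Cj * w z) ∧
              ∀ n : ℕ, 1 ≤ n → ∀ z₀ ∈ S,
                IsMonodromyAt (coeffA μ W V U p n) (matY μ p f w n) G (x j) z₀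
                  (monodromyMatrix Cj (expo W V (x j))))) := by

  refine ⟨fun n => ⟨hgen.natDegree_Theta_le hp n, hgen.toSeries_Theta n⟩,
    fun n hn => ⟨hgen.natDegree_Omega_le hp hn, hgen.toSeries_Omega n⟩,
    fun z hz => hgen.summable hz,
    fun D z₁ hD hDs hDx hz₁ hlarge => hgen.exists_isBranch hD hDs hDx hz₁ hlarge,
    fun D z₁ f w hb => ⟨fun n hn z hz => ⟨fun i k => ?_,
      hp.det_matY_ne_zero f w hn (hb.ne_zero_w z hz)⟩, fun j G hG hGs hxG hGx => ?_⟩⟩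
  -- The system on `D` is the case of the identity path over `ℂ`, with `f` and `w` themselves as the
  -- carried values.
  · have h := hp.hasDerivWithinAt_matY (μ := μ) (W := W) (V := V) (U := U) (γ := id) (φ := f)
      (ω := w) (γ' := 1) (s := univ) (t := z) hn (hgen.eval_ne_zero_of_avoids hb.avoids hz)
      (hb.ne_zero_w z hz) (hasDerivWithinAt_id z univ)
      (by simpa only [one_mul, hasDerivWithinAt_univ, id] using hb.hasDerivAt_f hgen hz)
      (by simpa only [one_mul, hasDerivWithinAt_univ, id] using hb.hasDerivAt_w hgen hz) i k
    rw [one_mul, hasDerivWithinAt_univ] at h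
    exact h
  · obtain ⟨W₁, hW, hW₁, hexpo⟩ := hgen.exists_factor j
    have hW₁G : ∀ z ∈ G, W₁.eval z ≠ 0 := fun z hz =>
      hW₁ z fun k hk hkz => hGx k hk (hkz ▸ hz)
    have hα : ∀ n : ℕ, 2 * V.eval (x j) / W₁.eval (x j) ≠ n := fun n => by
      rw [← hexpo]
      exact_mod_cast hgen.nonint j n
    obtain ⟨g, hg⟩ := exists_isHoloSolution (U := U) hG hGs hxG hW hW₁G hα
    refine ⟨g, hg, fun h hh => hh.eqOn hG hGs.isPathConnected.isConnected.isPreconnected hxG hW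
      (hW₁G _ hxG) hα hg, fun S hS hSO => ?_⟩
    obtain ⟨K, hK⟩ := hb.exists_connection hgen hG (x j) hg hS hSO
    refine ⟨K, hK, fun n hn z₀ hz₀ => ?_⟩
    rw [hexpo]
    exact hp.isMonodromyAt hG hGs hxG hW hW₁G hg (hK z₀ hz₀) (hb.ne_zero_w z₀ (hSO hz₀).1) hn
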